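/- Let $R=(E,(\rho_i)_{i\in I})$ be a relational structure on an infinite set $E$, where $\rho_i$ is an $m_i$-ary relation on $E$ and the signature $(m_i)_{i\in I}$ is arbitrary. For $A\subseteq E$ let $R_{\restriction A}$ be the induced structure on $A$, and for $n\in\mathbb{N}$ let $\varphi_R(n)$ be the number of isomorphism types of the structures $R_{\restriction A}$ with $A\subseteq E$, $|A|=n$. The function $\varphi_R$ is called the profile of $R$, and $\mathcal H_R(Z):=\sum_{n\ge 0}\varphi_R(n)Z^n$ is its generating series. A set partition of $E$ is a monomorphic decomposition of $R$ if $R_{\restriction A}\cong R_{\restriction A'}$ for all finite subsets $A,A'$ of $E$ such that $|A\cap F|=|A'\cap F|$ for every block $F$ of the partition. There is exactly one monomorphic decomposition of $R$ of which every other monomorphic decomposition of $R$ is a refinement; it is called the minimal one. The number of infinite blocks of the minimal monomorphic decomposition is the monomorphic dimension of $R$. Theorem. Suppose that $R$ has a monomorphic decomposition with finitely many blocks, and let $k$ be the monomorphic dimension of $R$. Then $k\ge 1$, $\varphi_R(n)$ is finite for every $n$, and the following hold. 1. There is a polynomial $P\in\mathbb{Z}[Z]$ with $P(1)\neq 0$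 such that $$\mathcal H_R(Z)=\frac{P(Z)}{(1-Z)(1-Z^2)\cdots(1-Z^k)}.$$ 2. The function $\varphi_R$ is eventually a quasi-polynomial of degree $k-1$: there are periodic functions $a_0,\dots,a_{k-1}:\mathbb{N}\to\mathbb{R}$, with $a_{k-1}$ not identically zero, such that $\varphi_R(n)=a_{k-1}(n)n^{k-1}+\cdots+a_1(n)n+a_0(n)$ for all large enough $n$. 3. There is a real number $a>0$ such that $\varphi_R(n)\sim a\,n^{k-1}$ as $n\to\infty$. -/

import Mathlib

universe u v w

namespace MonoDec

open FirstOrder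

section Defs

variable (L : FirstOrder.Language.{u, v}) [L.IsRelational] (E : Type w) [L.Structure E]

variable {E} in
/-- The restriction of the relational structure `E` to a subset `A`: as the language has no
function symbols, every subset of `E` carries an induced substructure. -/
def restriction (A : Set E) : L.Substructure E where
  carrier := A
  fun_mem := fun f => isEmptyElim f

variable {E} in
/-- Two finite subsets are equivalent when the restrictions to them are isomorphic. -/
def SameType (A B : Finset E) : Prop :=
  Nonempty (restriction L (A : Set E) ≃[L] restriction L (B : Set E))

/-- The relation `SameType` on the `n`-element subsets of `E`. -/
def typeSetoid (n : ℕ) : Setoid {A : Finset E // A.card = n} where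
  r A B := SameType L A.1 B.1
  iseqv :=
    { refl := fun _ => ⟨FirstOrder.Language.Equiv.refl L _⟩
      symm := fun ⟨e⟩ => ⟨e.symm⟩
      trans := fun ⟨e⟩ ⟨f⟩ => ⟨f.comp e⟩ }

/-- The isomorphism types of the restrictions of `E` to its `n`-element subsets. -/
abbrev IsoTypes (n : ℕ) : Type w := Quotient (typeSetoid L E n)

/-- The profile: the number of isomorphism types of restrictions to `n`-element subsets. -/
noncomputable def profile (n : ℕ) : ℕ := Nat.card (IsoTypes L E n)

/-- The generating series of the profile. -/
noncomputable def generatingSeries : PowerSeries ℤ :=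
  PowerSeries.mk fun n => (profile L E n : ℤ)

variable {E} in
/-- A set partition of `E`, given as an equivalence relation, is a monomorphic decomposition if
any two finite subsets that meet every block in the same number of elements are isomorphic. -/
def IsMonomorphicDecomposition (s : Setoid E) : Prop :=
  ∀ A B : Finset E,
    (∀ c ∈ s.classes, ((A : Set E) ∩ c).ncard = ((B : Set E) ∩ c).ncard) → SameType L A B

/-- There is a monomorphic decomposition with finitely many blocks. -/
def HasFiniteMonomorphicDecomposition : Prop :=
  ∃ s : Setoid E, IsMonomorphicDecomposition L s ∧ s.classes.Finite

/-- The minimal monomorphic decomposition: the coarsest one. That this supremum is itself a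
monomorphic decomposition, refined by every other one, is
`isGreatest_minimalMonomorphicDecomposition` below. -/
def minimalMonomorphicDecomposition : Setoid E :=
  sSup {s : Setoid E | IsMonomorphicDecomposition L s}

/-- The monomorphic dimension: the number of infinite blocks of the minimal monomorphic
decomposition. -/
noncomputable def monomorphicDimension : ℕ :=
  {c ∈ (minimalMonomorphicDecomposition L E).classes | c.Infinite}.ncard

end Defs

/-- A function on `ℕ` is a quasi-polynomial of degree `d` if it has the form
`a_d(n) n ^ d + ⋯ + a_0(n)` with periodic coefficients, where `a_d` is not identically zero. -/
def IsQuasiPolynomialOfDegree (f : ℕ → ℝ) (d : ℕ) : Prop :=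
  ∃ a : ℕ → ℕ → ℝ,
    (∀ i ≤ d, ∃ p : ℕ, 0 < p ∧ Function.Periodic (a i) p) ∧
    (∃ n, a d n ≠ 0) ∧
    ∀ n, f n = ∑ i ∈ Finset.range (d + 1), a i n * (n : ℝ) ^ i

/-! ### The minimal monomorphic decomposition is well defined -/

section Minimal

variable (L : FirstOrder.Language.{u, v}) [L.IsRelational] {E : Type w} [L.Structure E]

theorem SameType.refl (A : Finset E) : SameType L A A := ⟨FirstOrder.Language.Equiv.refl L _⟩

variable {L} in
theorem SameType.trans {A B C : Finset E} (h : SameType L A B) (h' : SameType L B C) :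
    SameType L A C := by
  obtain ⟨e⟩ := h
  obtain ⟨f⟩ := h'
  exact ⟨f.comp e⟩

variable {L} in
theorem SameType.symm {A B : Finset E} (h : SameType L A B) : SameType L B A := by
  obtain ⟨e⟩ := h
  exact ⟨e.symm⟩

open Classical in
/-- Two points are exchangeable if replacing one by the other in a finite set never changes the
isomorphism type. -/
def exchangeSetoid (E : Type w) [L.Structure E] : Setoid E where
  r x y := ∀ B : Finset E, x ∉ B → y ∉ B → SameType L (insert x B) (insert y B)
  iseqv :=
    { refl := fun x B _ _ => SameType.refl L _
      symm := fun h B hx hy => (h B hy hx).symm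
      trans := by
        intro x y z hxy hyz B hx hz
        by_cases hxz : x = z
        · subst hxz; exact SameType.refl L _
        by_cases hy : y ∈ B
        · obtain ⟨C, hyC, rfl⟩ : ∃ C, y ∉ C ∧ insert y C = B :=
            ⟨B.erase y, Finset.notMem_erase y B, Finset.insert_erase hy⟩
          simp only [Finset.mem_insert, not_or] at hx hz
          have h1 := hyz (insert x C) (by simp [hyC, Ne.symm hx.1])
            (by simp [hz.2, Ne.symm hxz])
          have h2 := hxy (insert z C) (by simp [hx.2, hxz]) (by simp [hyC, Ne.symm hz.1])
          rw [Finset.insert_comm y x C, Finset.insert_comm z x C] at h1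
          rw [Finset.insert_comm y z C] at h2
          exact h1.trans h2
        · exact (hxy B hx hy).trans (hyz B hy hz) }

open Classical in
theorem isMonomorphicDecomposition_exchangeSetoid :
    IsMonomorphicDecomposition L (exchangeSetoid L E) := by
  intro A B
  induction hm : (A \ B).card generalizing A with
  | zero =>
    intro h
    have hsub : A ⊆ B := by
      rwa [Finset.card_eq_zero, Finset.sdiff_eq_empty_iff_subset] at hm
    have : A = B := by
      refine Finset.Subset.antisymm hsub fun b hb => ?_
      have hc := h _ ((exchangeSetoid L E).mem_classes b)
      have := Set.eq_of_subset_of_ncard_le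
        (Set.inter_subset_inter_left _ (Finset.coe_subset.2 hsub)) hc.ge
        (B.finite_toSet.inter_of_left _)
      have hb' : b ∈ (A : Set E) ∩ {x | (exchangeSetoid L E) x b} := by
        rw [this]; exact ⟨hb, (exchangeSetoid L E).refl b⟩
      exact hb'.1
    rw [this]
    exact SameType.refl L _
  | succ m ih =>
    intro h
    obtain ⟨a, ha⟩ : (A \ B).Nonempty := by
      rw [← Finset.card_pos]; omega
    obtain ⟨haA, haB⟩ := Finset.mem_sdiff.1 ha
    have hcl := (exchangeSetoid L E).mem_classes a
    have hc := h _ hcl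
    obtain ⟨b, ⟨hbB, hba⟩, hbA⟩ :
        ∃ b ∈ (B : Set E) ∩ {x | (exchangeSetoid L E) x a},
          b ∉ (A : Set E) ∩ {x | (exchangeSetoid L E) x a} := by
      by_contra hcon
      push Not at hcon
      have := Set.eq_of_subset_of_ncard_le hcon hc.le (A.finite_toSet.inter_of_left _)
      have : a ∈ (B : Set E) ∩ {x | (exchangeSetoid L E) x a} := by
        rw [this]; exact ⟨haA, (exchangeSetoid L E).refl a⟩
      exact haB this.1
    have hbA : b ∉ A := fun hb => hbA ⟨hb, hba⟩
    have hbB : b ∈ B := hbB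
    have hba : (exchangeSetoid L E) b a := hba
    have hab : (exchangeSetoid L E) a b := (exchangeSetoid L E).symm hba
    have h1 : SameType L A (insert b (A.erase a)) := by
      have := hab (A.erase a) (Finset.notMem_erase _ _)
        (fun hb => hbA (Finset.mem_of_mem_erase hb))
      rwa [Finset.insert_erase haA] at this
    refine h1.trans (ih _ ?_ ?_)
    · have : insert b (A.erase a) \ B = (A \ B).erase a := by
        ext x
        simp only [Finset.mem_sdiff, Finset.mem_insert, Finset.mem_erase]
        constructor
        · rintro ⟨rfl | hx, hxB⟩
          · exact absurd hbB hxB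
          · exact ⟨hx.1, hx.2, hxB⟩
        · rintro ⟨hx, hxA, hxB⟩
          exact ⟨Or.inr ⟨hx, hxA⟩, hxB⟩
      rw [this, Finset.card_erase_of_mem ha, hm]; rfl
    · intro c hcc
      rw [← h c hcc]
      obtain ⟨y, rfl⟩ := hcc
      have key : a ∈ {x | (exchangeSetoid L E) x y} ↔ b ∈ {x | (exchangeSetoid L E) x y} :=
        ⟨fun hay => (exchangeSetoid L E).trans hba hay,
          fun hby => (exchangeSetoid L E).trans hab hby⟩
      have hd : ((A : Set E) \ {a}) ∩ {x | (exchangeSetoid L E) x y} =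
          ((A : Set E) ∩ {x | (exchangeSetoid L E) x y}) \ {a} := by
        ext t
        simp only [Set.mem_inter_iff, Set.mem_sdiff]
        tauto
      by_cases hay : a ∈ {x | (exchangeSetoid L E) x y}
      · have hby := key.1 hay
        rw [Finset.coe_insert, Finset.coe_erase, Set.insert_inter_of_mem hby,
          hd]
        rw [Set.ncard_insert_of_notMem (fun hb => hbA hb.1.1)
          ((A.finite_toSet.inter_of_left _).sdiff)]
        exact Set.ncard_sdiff_singleton_add_one
          (show a ∈ (A : Set E) ∩ {x | (exchangeSetoid L E) x y} from ⟨haA, hay⟩)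
          (A.finite_toSet.inter_of_left _)
      · have hby := fun hb => hay (key.2 hb)
        rw [Finset.coe_insert, Finset.coe_erase, Set.insert_inter_of_notMem hby,
          hd, Set.sdiff_singleton_eq_self (fun hb => hay hb.2)]

open Classical in
theorem le_exchangeSetoid {s : Setoid E} (hs : IsMonomorphicDecomposition L s) :
    s ≤ exchangeSetoid L E := by
  intro x y hxy B hx hy
  refine hs _ _ ?_
  rintro c ⟨z, rfl⟩
  have key : x ∈ {t | s t z} ↔ y ∈ {t | s t z} :=
    ⟨fun h => s.trans (s.symm hxy) h, fun h => s.trans hxy h⟩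
  by_cases h : x ∈ {t | s t z}
  · rw [Finset.coe_insert, Finset.coe_insert, Set.insert_inter_of_mem h,
      Set.insert_inter_of_mem (key.1 h),
      Set.ncard_insert_of_notMem (fun hb => hx hb.1) (B.finite_toSet.inter_of_left _),
      Set.ncard_insert_of_notMem (fun hb => hy hb.1) (B.finite_toSet.inter_of_left _)]
  · rw [Finset.coe_insert, Finset.coe_insert, Set.insert_inter_of_notMem h,
      Set.insert_inter_of_notMem (fun hb => h (key.2 hb))]

/-- There is a monomorphic decomposition of which every other one is a refinement, and it is
`minimalMonomorphicDecomposition`. -/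
theorem isGreatest_minimalMonomorphicDecomposition (E : Type w) [L.Structure E] :
    IsGreatest {s : Setoid E | IsMonomorphicDecomposition L s}
      (minimalMonomorphicDecomposition L E) := by
  have h : IsGreatest {s : Setoid E | IsMonomorphicDecomposition L s} (exchangeSetoid L E) :=
    ⟨isMonomorphicDecomposition_exchangeSetoid L, fun _ hs => le_exchangeSetoid L hs⟩
  have he : minimalMonomorphicDecomposition L E = exchangeSetoid L E := h.isLUB.sSup_eq
  rwa [he]

end Minimal

end MonoDec

namespace MonoDec

open FirstOrder Classical

/-! ### Isomorphisms between finite restrictions, as graphs -/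

section IsoGraph

variable (L : FirstOrder.Language.{u, v}) {E : Type w} [L.Structure E]

/-! The blocks of the minimal decomposition are the classes of exchangeable points of `E`; `cls : E
→ X` maps a point to its block, `X` is finite, and the type of a finite set depends only on its
counts in the blocks. Different count vectors may give the same type, so types are studied through
an intrinsic invariant: a finite set `S` has its own exchangeability classes (`ExchIn`), unions of
traces of blocks of `E`, and the multiset `sizes` of their cardinalities is preserved by
isomorphism.

Dickson's lemma gives a level `d` (`IsLevel`): adding points to blocks that already have `d` points
in `S` does not change exchangeability between points of `S`, and the analogous statement holds for
pairs added to an isomorphism. Hence, for `u` large, adding one point to every class of `S` of size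
at least `u` (`Up`) is well defined on isomorphism types (`SameType.up`), injective
(`SameType.down`), and reversible whenever no class of the larger set has size `u` (`exists_down`).

View `sizes` as a Young diagram with one row per class. Beyond column `D` the columns have height at
most `k`, because a class that long meets an infinite block in many points. `Up` at `u` duplicates
column `u`, so it raises by one the number `gap D _ i` of columns of a given height `i`. Therefore
the number of types with prescribed part up to column `D` (`low`) and prescribed gaps depends only
on which gaps are positive (`card_types_min`). Summing over the set `I` of positive gaps, the
generating series is the sum of `G I * ∏ i ∈ I, Z^i / (1 - Z^i)`, with polynomials `G I` having
nonnegative coefficients. In the common numerator only the full set `I` survives at `Z = 1`, and it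
contributes a positive number because some type has all gaps positive (`exists_gap_pos`).

The asymptotics come from counting partitions into parts of size at most `k`. Quasi-polynomiality
comes from replacing the denominator by a power of `1 - Z^N` with `N = k!`; the leading coefficient
is nonzero because of the asymptotics. -/

/-- A finite set of pairs is the graph of an isomorphism between two finite restrictions. -/
def IsIsoGraph (Γ : Finset (E × E)) : Prop :=
  (∀ p ∈ Γ, ∀ q ∈ Γ, p.1 = q.1 ↔ p.2 = q.2) ∧
    ∀ (n : ℕ) (r : L.Relations n) (p : Fin n → E × E), (∀ i, p i ∈ Γ) →
      (Language.Structure.RelMap r (fun i => (p i).1) ↔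
        Language.Structure.RelMap r (fun i => (p i).2))

variable {L}

/-- Only tuples of pairs in the set are constrained, so isomorphism graphs are closed under subsets.
This makes Dickson's lemma applicable to their count vectors. -/
theorem IsIsoGraph.mono {Γ Δ : Finset (E × E)} (h : IsIsoGraph L Δ) (hs : Γ ⊆ Δ) :
    IsIsoGraph L Γ :=
  ⟨fun p hp q hq => h.1 p (hs hp) q (hs hq), fun n r p hp => h.2 n r p fun i => hs (hp i)⟩

theorem IsIsoGraph.swap {Γ : Finset (E × E)} (h : IsIsoGraph L Γ) :
    IsIsoGraph L (Γ.image Prod.swap) := by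
  have key : ∀ p ∈ Γ.image Prod.swap, p.swap ∈ Γ := by
    intro p hp
    obtain ⟨q, hq, rfl⟩ := Finset.mem_image.1 hp
    simpa using hq
  exact ⟨fun p hp q hq => (h.1 _ (key p hp) _ (key q hq)).symm,
    fun n r p hp => (h.2 n r (fun i => (p i).swap) fun i => key _ (hp i)).symm⟩

theorem isIsoGraph_diag (A : Finset E) : IsIsoGraph L (A.image fun a => (a, a)) := by
  have key : ∀ p ∈ A.image fun a => (a, a), p.1 = p.2 := by
    intro p hp
    obtain ⟨q, hq, rfl⟩ := Finset.mem_image.1 hp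
    rfl
  refine ⟨fun p hp q hq => by rw [key p hp, key q hq], fun n r p hp => ?_⟩
  have : (fun i => (p i).1) = fun i => (p i).2 := funext fun i => key _ (hp i)
  rw [this]

theorem IsIsoGraph.sameType [L.IsRelational] {Γ : Finset (E × E)} (h : IsIsoGraph L Γ) :
    SameType L (Γ.image Prod.fst) (Γ.image Prod.snd) := by
  have h1 : ∀ a : restriction L ((Γ.image Prod.fst : Finset E) : Set E),
      ∃ p ∈ Γ, p.1 = (a : E) := fun a => by
    have := a.2
    exact Finset.mem_image.1 (Finset.mem_coe.1 this)
  have h2 : ∀ a : restriction L ((Γ.image Prod.snd : Finset E) : Set E),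
      ∃ p ∈ Γ, p.2 = (a : E) := fun a => by
    have := a.2
    exact Finset.mem_image.1 (Finset.mem_coe.1 this)
  choose f hf hf' using h1
  choose g hg hg' using h2
  refine ⟨⟨⟨fun a => ⟨(f a).2, Finset.mem_coe.2 (Finset.mem_image_of_mem _ (hf a))⟩,
    fun b => ⟨(g b).1, Finset.mem_coe.2 (Finset.mem_image_of_mem _ (hg b))⟩, ?_, ?_⟩, ?_, ?_⟩⟩
  · intro a
    refine Subtype.ext ?_
    exact ((h.1 _ (hg _) _ (hf a)).2 (hg' _)).trans (hf' a)
  · intro b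
    refine Subtype.ext ?_
    exact ((h.1 _ (hf _) _ (hg b)).1 (hf' _)).trans (hg' b)
  · intro n φ
    exact isEmptyElim φ
  · intro n r x
    have := h.2 n r (fun i => f (x i)) fun i => hf _
    simp only [hf'] at this
    exact this.symm

theorem SameType.exists_isIsoGraph [L.IsRelational] {A B : Finset E} (h : SameType L A B) :
    ∃ Γ : Finset (E × E), IsIsoGraph L Γ ∧ Γ.image Prod.fst = A ∧ Γ.image Prod.snd = B := by
  obtain ⟨e⟩ := h
  have hA : ∀ a : A, (a : E) ∈ restriction L (A : Set E) := fun a => a.2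
  have hB : ∀ a : A, ((e ⟨a, hA a⟩ : restriction L (B : Set E)) : E) ∈ B := fun a =>
    (e ⟨a, hA a⟩).2
  refine ⟨A.attach.image fun a : A => ((a : E), ((e ⟨a, hA a⟩ : restriction L (B : Set E)) : E)),
    ⟨?_, ?_⟩, ?_, ?_⟩
  · intro p hp q hq
    obtain ⟨a, -, rfl⟩ := Finset.mem_image.1 hp
    obtain ⟨b, -, rfl⟩ := Finset.mem_image.1 hq
    simp only
    rw [← Subtype.ext_iff, ← Subtype.ext_iff, e.injective.eq_iff, Subtype.ext_iff, Subtype.ext_iff]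
  · intro n r p hp
    choose f _ hf using fun i => Finset.mem_image.1 (hp i)
    have := e.map_rel r fun i => ⟨f i, hA (f i)⟩
    simp only [← hf]
    exact this.symm
  · ext x
    simp only [Finset.mem_image, Finset.mem_attach, true_and, Subtype.exists]
    constructor
    · rintro ⟨_, ⟨a, ha, rfl⟩, rfl⟩
      exact ha
    · intro hx
      exact ⟨_, ⟨x, hx, rfl⟩, rfl⟩
  · ext x
    simp only [Finset.mem_image, Finset.mem_attach, true_and, Subtype.exists]
    constructor
    · rintro ⟨_, ⟨a, ha, rfl⟩, rfl⟩
      exact hB ⟨a, ha⟩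
    · intro hx
      obtain ⟨a, ha⟩ := e.surjective ⟨x, hx⟩
      exact ⟨_, ⟨a, a.2, rfl⟩, by simp [ha]⟩

theorem IsIsoGraph.card_fst {Γ : Finset (E × E)} (h : IsIsoGraph L Γ) :
    (Γ.image Prod.fst).card = Γ.card :=
  Finset.card_image_of_injOn fun p hp q hq hpq =>
    Prod.ext hpq ((h.1 p hp q hq).1 hpq)

theorem IsIsoGraph.card_snd {Γ : Finset (E × E)} (h : IsIsoGraph L Γ) :
    (Γ.image Prod.snd).card = Γ.card :=
  Finset.card_image_of_injOn fun p hp q hq hpq =>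
    Prod.ext ((h.1 p hp q hq).2 hpq) hpq

end IsoGraph

/-! ### Counting vectors and Dickson's lemma -/

section Count

variable {α X : Type*}

/-- The number of elements of `A` in the fibre of `c` over `x`. -/
noncomputable def cnt (c : α → X) (A : Finset α) (x : X) : ℕ := (A.filter fun a => c a = x).card

theorem card_filter_eq_cnt (c : α → X) (A : Finset α) (x : X) [DecidablePred fun a => c a = x] :
    (A.filter fun a => c a = x).card = cnt c A x := by
  unfold cnt
  congr

theorem exists_card_eq_cnt (c : α → X) (A : Finset α) (x : X) :
    ∃ B ⊆ A, B.card = cnt c A x ∧ ∀ a ∈ B, c a = x :=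
  ⟨_, Finset.filter_subset _ _, card_filter_eq_cnt c A x, fun _ ha => (Finset.mem_filter.1 ha).2⟩

theorem cnt_mono (c : α → X) {A B : Finset α} (h : A ⊆ B) (x : X) : cnt c A x ≤ cnt c B x :=
  Finset.card_le_card (Finset.filter_subset_filter _ h)

theorem cnt_union (c : α → X) {A B : Finset α} (h : Disjoint A B) (x : X) :
    cnt c (A ∪ B) x = cnt c A x + cnt c B x := by
  unfold cnt
  rw [Finset.filter_union, Finset.card_union_of_disjoint (Finset.disjoint_filter_filter h)]

theorem cnt_insert (c : α → X) {A : Finset α} {a : α} (h : a ∉ A) (x : X) :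
    cnt c (insert a A) x = cnt c A x + if c a = x then 1 else 0 := by
  unfold cnt
  rw [Finset.filter_insert]
  split_ifs with h1
  · rw [Finset.card_insert_of_notMem (by simp [h])]
  · rfl

theorem exists_subset_cnt_eq (c : α → X) (A : Finset α) (v : X → ℕ) (h : ∀ x, v x ≤ cnt c A x) :
    ∃ B ⊆ A, ∀ x, cnt c B x = v x := by
  choose f hf hf' using fun x => Finset.exists_subset_card_eq (h x)
  refine ⟨A.filter fun a => a ∈ f (c a), Finset.filter_subset _ _, fun x => ?_⟩
  rw [← hf' x, cnt]
  congr 1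
  ext a
  simp only [Finset.mem_filter]
  constructor
  · rintro ⟨⟨_, h⟩, rfl⟩
    exact h
  · intro ha
    have := Finset.mem_filter.1 (hf x ha)
    obtain ⟨h1, rfl⟩ := this
    exact ⟨⟨h1, ha⟩, rfl⟩

/-- A downward closed property of vectors of natural numbers is determined by the truncation of
the vector at some level. -/
theorem exists_truncation_level [Finite X] (P : (X → ℕ) → Prop)
    (hP : ∀ v w, v ≤ w → P w → P v) : ∃ d : ℕ, ∀ v, P (fun x => min (v x) d) → P v := by
  cases nonempty_fintype X
  let s : Set (X → ℕ) := {v | ¬ P v}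
  -- Dickson's lemma: the minimal counterexamples form an antichain in a well quasi-order, hence are
  -- finitely many, and `d` bounds all their coordinates.
  have hfin : {v | Minimal (· ∈ s) v}.Finite :=
    WellQuasiOrderedLE.finite_of_isAntichain (setOfPred_minimal_antichain _)
  obtain ⟨d, hd⟩ : ∃ d : ℕ, ∀ v, Minimal (· ∈ s) v → ∀ x, v x ≤ d := by
    refine ⟨hfin.toFinset.sup fun v => Finset.univ.sup v, fun v hv x => ?_⟩
    exact (Finset.le_sup (f := v) (Finset.mem_univ x)).trans
      (Finset.le_sup (f := fun v => Finset.univ.sup v) (hfin.mem_toFinset.2 hv))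
  refine ⟨d, fun v hv => ?_⟩
  by_contra hcon
  -- A minimal counterexample below `v` has coordinates at most `d`, so it also lies below the
  -- truncation of `v`.
  obtain ⟨m, hmv, hm⟩ := exists_minimal_le_of_wellFoundedLT (· ∈ s) v hcon
  exact hm.prop (hP _ _ (fun x => le_min (hmv x) (hd m hm x)) hv)

end Count

end MonoDec

namespace MonoDec

open FirstOrder Classical

/-! ### Exchangeability inside a finite subset -/

section ExchIn

variable (L : FirstOrder.Language.{u, v}) [L.IsRelational] {E : Type w} [L.Structure E]

/-- Two points are exchangeable in `S` if replacing one by the other in a subset of `S` never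
changes the isomorphism type. -/
def ExchIn (S : Finset E) (x y : E) : Prop :=
  ∀ B ⊆ S, x ∉ B → y ∉ B → SameType L (insert x B) (insert y B)

variable {L} {S T : Finset E} {x y z : E}

theorem ExchIn.refl (S : Finset E) (x : E) : ExchIn L S x x := fun _ _ _ _ => SameType.refl L _

theorem ExchIn.symm (h : ExchIn L S x y) : ExchIn L S y x :=
  fun B hB hy hx => (h B hB hx hy).symm

theorem ExchIn.mono (h : ExchIn L T x y) (hST : S ⊆ T) : ExchIn L S x y :=
  fun B hB => h B (hB.trans hST)

/-- If `y` lies in `B = C ∪ {y}`, the chain is `C ∪ {x, y}`, `C ∪ {x, z}`, `C ∪ {y, z}`. Its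
exchanges take place over `C ∪ {x}` and `C ∪ {z}`, which must lie in `S`; hence the two membership
hypotheses. -/
theorem ExchIn.trans (h : ExchIn L S x y) (h' : ExchIn L S y z) (hxS : x ∈ S) (hzS : z ∈ S) :
    ExchIn L S x z := by
  intro B hB hx hz
  by_cases hxz : x = z
  · subst hxz; exact SameType.refl L _
  by_cases hy : y ∈ B
  · obtain ⟨C, hyC, rfl⟩ : ∃ C, y ∉ C ∧ insert y C = B :=
      ⟨B.erase y, Finset.notMem_erase y B, Finset.insert_erase hy⟩
    have hC : C ⊆ S := (Finset.subset_insert _ _).trans hB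
    simp only [Finset.mem_insert, not_or] at hx hz
    have h1 := h' (insert x C) (Finset.insert_subset hxS hC) (by simp [hyC, Ne.symm hx.1])
      (by simp [hz.2, Ne.symm hxz])
    have h2 := h (insert z C) (Finset.insert_subset hzS hC) (by simp [hx.2, hxz])
      (by simp [hyC, Ne.symm hz.1])
    rw [Finset.insert_comm y x C, Finset.insert_comm z x C] at h1
    rw [Finset.insert_comm y z C] at h2
    exact h1.trans h2
  · exact (h B hB hx hy).trans (h' B hB hy hz)

theorem ExchIn.congr_left (h : ExchIn L S x y) (hx : x ∈ S) (hy : y ∈ S) (hz : z ∈ S) :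
    ExchIn L S x z ↔ ExchIn L S y z :=
  ⟨fun h' => h.symm.trans h' hy hz, fun h' => h.trans h' hx hz⟩

/-- Two subsets of `S` that meet every exchangeability class of `S` in the same number of points
are isomorphic. -/
theorem sameType_of_exchIn (S : Finset E) : ∀ A B : Finset E, A ⊆ S → B ⊆ S →
    (∀ s ∈ S, (A.filter (ExchIn L S s)).card = (B.filter (ExchIn L S s)).card) →
      SameType L A B := by
  intro A B
  induction hm : (A \ B).card generalizing A with
  | zero =>
    intro hA hB h
    have hsub : A ⊆ B := by
      rwa [Finset.card_eq_zero, Finset.sdiff_eq_empty_iff_subset] at hm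
    have : A = B := by
      refine Finset.Subset.antisymm hsub fun b hb => ?_
      have := Finset.eq_of_subset_of_card_le (Finset.filter_subset_filter _ hsub) (h b (hB hb)).ge
      have hb' : b ∈ A.filter (ExchIn L S b) := by
        rw [this]; exact Finset.mem_filter.2 ⟨hb, ExchIn.refl S b⟩
      exact (Finset.mem_filter.1 hb').1
    rw [this]
    exact SameType.refl L _
  | succ m ih =>
    intro hA hB h
    obtain ⟨a, ha⟩ : (A \ B).Nonempty := by
      rw [← Finset.card_pos]; omega
    obtain ⟨haA, haB⟩ := Finset.mem_sdiff.1 ha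
    have hc := h a (hA haA)
    -- The class of `a` has as many points in `A` as in `B`, and `a` is missing from `B`, so some
    -- `b` of this class lies in `B` but not in `A`. Exchanging `a` for `b` shrinks `A \ B`.
    obtain ⟨b, hb1, hb2⟩ : ∃ b ∈ B.filter (ExchIn L S a), b ∉ A.filter (ExchIn L S a) := by
      by_contra hcon
      push Not at hcon
      have h1 := Finset.eq_of_subset_of_card_le hcon hc.le
      have h2 : a ∈ B.filter (ExchIn L S a) := by
        rw [h1]; exact Finset.mem_filter.2 ⟨haA, ExchIn.refl S a⟩
      exact haB (Finset.mem_filter.1 h2).1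
    obtain ⟨hbB, hab⟩ := Finset.mem_filter.1 hb1
    have hbA : b ∉ A := fun hb => hb2 (Finset.mem_filter.2 ⟨hb, hab⟩)
    have h1 : SameType L A (insert b (A.erase a)) := by
      have := hab (A.erase a) ((Finset.erase_subset _ _).trans hA) (Finset.notMem_erase _ _)
        (fun hb => hbA (Finset.mem_of_mem_erase hb))
      rwa [Finset.insert_erase haA] at this
    refine h1.trans (ih _ ?_ ?_ hB ?_)
    · have : insert b (A.erase a) \ B = (A \ B).erase a := by
        ext x
        simp only [Finset.mem_sdiff, Finset.mem_insert, Finset.mem_erase]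
        constructor
        · rintro ⟨rfl | hx, hxB⟩
          · exact absurd hbB hxB
          · exact ⟨hx.1, hx.2, hxB⟩
        · rintro ⟨hx, hxA, hxB⟩
          exact ⟨Or.inr ⟨hx, hxA⟩, hxB⟩
      rw [this, Finset.card_erase_of_mem ha, hm]; rfl
    · exact Finset.insert_subset (hB hbB) ((Finset.erase_subset _ _).trans hA)
    · intro s hs
      rw [← h s hs]
      have key : ExchIn L S s a ↔ ExchIn L S s b :=
        ⟨fun h' => h'.trans hab hs (hB hbB), fun h' => h'.trans hab.symm hs (hA haA)⟩
      rw [Finset.filter_insert, Finset.filter_erase]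
      by_cases h' : ExchIn L S s a
      · rw [if_pos (key.1 h'), Finset.card_insert_of_notMem (by simp [hbA]),
          Finset.card_erase_add_one (by simp [haA, h'])]
      · rw [if_neg (fun h'' => h' (key.2 h'')), Finset.erase_eq_of_notMem (by simp [h'])]

/-- Pull `B` back along `Γ`. Restrictions of `Γ` identify each set `B ∪ {r.2}` with the pullback of
`B` together with `r.1`, so an exchange on the left gives one on the right. -/
theorem IsIsoGraph.exchIn {Γ : Finset (E × E)} (hΓ : IsIsoGraph L Γ) {p q : E × E} (hp : p ∈ Γ)
    (hq : q ∈ Γ) (h : ExchIn L (Γ.image Prod.fst) p.1 q.1) :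
    ExchIn L (Γ.image Prod.snd) p.2 q.2 := by
  intro B hB hpB hqB
  have hsub : Γ.filter (fun r => r.2 ∈ B) ⊆ Γ := Finset.filter_subset _ _
  have himg : (Γ.filter fun r => r.2 ∈ B).image Prod.snd = B := by
    ext b
    simp only [Finset.mem_image, Finset.mem_filter]
    constructor
    · rintro ⟨r, ⟨_, hr⟩, rfl⟩
      exact hr
    · intro hb
      obtain ⟨r, hr, rfl⟩ := Finset.mem_image.1 (hB hb)
      exact ⟨r, ⟨hr, hb⟩, rfl⟩
  have hnot : ∀ r ∈ Γ, r.2 ∉ B → r.1 ∉ (Γ.filter fun r => r.2 ∈ B).image Prod.fst := by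
    intro r hr hrB hcon
    obtain ⟨t, ht, htr⟩ := Finset.mem_image.1 hcon
    obtain ⟨ht1, ht2⟩ := Finset.mem_filter.1 ht
    rw [(hΓ.1 t ht1 r hr).1 htr] at ht2
    exact hrB ht2
  have hins : ∀ r ∈ Γ, SameType L (insert r.1 ((Γ.filter fun r => r.2 ∈ B).image Prod.fst))
      (insert r.2 B) := by
    intro r hr
    have := (hΓ.mono (Finset.insert_subset hr hsub)).sameType
    rwa [Finset.image_insert, Finset.image_insert, himg] at this
  exact ((hins p hp).symm.trans
    (h _ (Finset.image_subset_image hsub) (hnot p hp hpB) (hnot q hq hqB))).trans (hins q hq)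

theorem IsIsoGraph.exchIn_iff {Γ : Finset (E × E)} (hΓ : IsIsoGraph L Γ) {p q : E × E}
    (hp : p ∈ Γ) (hq : q ∈ Γ) :
    ExchIn L (Γ.image Prod.fst) p.1 q.1 ↔ ExchIn L (Γ.image Prod.snd) p.2 q.2 := by
  refine ⟨hΓ.exchIn hp hq, fun h => ?_⟩
  have h1 : (Γ.image Prod.swap).image Prod.fst = Γ.image Prod.snd := by
    rw [Finset.image_image]; rfl
  have h2 : (Γ.image Prod.swap).image Prod.snd = Γ.image Prod.fst := by
    rw [Finset.image_image]; rfl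
  have := hΓ.swap.exchIn (Finset.mem_image_of_mem _ hp) (Finset.mem_image_of_mem _ hq)
    (by rw [h1]; exact h)
  rwa [h2] at this

end ExchIn

/-! ### Truncation levels -/

section Levels

variable {L : FirstOrder.Language.{u, v}} [L.IsRelational] {E : Type w} [L.Structure E]
  {X : Type*} {cls : E → X}

theorem exchIn_of_cls_eq
    (hcls : ∀ A B : Finset E, (∀ x, cnt cls A x = cnt cls B x) → SameType L A B)
    {a b : E} (hab : cls a = cls b) (S : Finset E) : ExchIn L S a b := by
  intro B _ ha hb
  refine hcls _ _ fun x => ?_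
  rw [cnt_insert cls ha, cnt_insert cls hb, hab]

/-- Exchangeability is inherited by a larger set, if points are added only to blocks that already
contain many points. -/
theorem exists_exchIn_level [Finite X]
    (hcls : ∀ A B : Finset E, (∀ x, cnt cls A x = cnt cls B x) → SameType L A B) :
    ∃ d : ℕ, ∀ d' ≥ d, ∀ S S' : Finset E, S ⊆ S' →
      (∀ x, cnt cls S' x ≤ cnt cls S x ∨ d' ≤ cnt cls S x) →
      ∀ a ∈ S, ∀ b ∈ S, ExchIn L S a b → ExchIn L S' a b := by
  cases nonempty_fintype X
  -- The property mentions only the blocks of the two points and an upper bound on counts, so it is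
  -- downward closed in `v`. There are finitely many pairs of blocks, so one level serves all.
  let P : X × X → (X → ℕ) → Prop := fun p v => ∀ (B : Finset E) (a b : E), cls a = p.1 →
    cls b = p.2 → a ∉ B → b ∉ B → (∀ x, cnt cls (insert a (insert b B)) x ≤ v x) →
      SameType L (insert a B) (insert b B)
  have hP : ∀ p v w, v ≤ w → P p w → P p v := fun p v w hvw h B a b ha hb haB hbB hle =>
    h B a b ha hb haB hbB fun x => (hle x).trans (hvw x)
  choose d hd using fun p => exists_truncation_level (P p) (hP p)
  refine ⟨Finset.univ.sup d, fun d' hd' S S' hsub hSS' a ha b hb hab => ?_⟩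
  have h1 : P (cls a, cls b) (cnt cls S) := by
    intro B a' b' ha' hb' ha'B hb'B hle
    by_cases hab' : a' = b'
    · subst hab'; exact SameType.refl L _
    by_cases hne : a = b
    · subst hne
      exact exchIn_of_cls_eq hcls (ha'.trans hb'.symm) B B (Finset.Subset.refl _) ha'B hb'B
    -- Since only counts matter, the test set `B` is replaced by a copy inside `S` that avoids `a`
    -- and `b`.
    obtain ⟨C, hC, hCB⟩ := exists_subset_cnt_eq cls ((S.erase a).erase b) (cnt cls B) (by
      intro x
      have h1 := hle x
      rw [cnt_insert cls (by simp [ha'B, hab']), cnt_insert cls hb'B] at h1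
      have h2 := cnt_insert cls (Finset.notMem_erase b (S.erase a)) x
      have h3 := cnt_insert cls (Finset.notMem_erase a S) x
      rw [Finset.insert_erase (by simp [hb, Ne.symm hne])] at h2
      rw [Finset.insert_erase ha] at h3
      simp only at ha' hb'
      rw [ha', hb'] at h1
      omega)
    have haC : a ∉ C := fun h => by simpa using hC h
    have hbC : b ∉ C := fun h => by simpa using hC h
    have e1 : SameType L (insert a' B) (insert a C) := hcls _ _ fun x => by
      rw [cnt_insert cls ha'B, cnt_insert cls haC, hCB, ha']
    have e2 : SameType L (insert b' B) (insert b C) := hcls _ _ fun x => by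
      rw [cnt_insert cls hb'B, cnt_insert cls hbC, hCB, hb']
    exact (e1.trans (hab C (hC.trans ((Finset.erase_subset _ _).trans (Finset.erase_subset _ _)))
      haC hbC)).trans e2.symm
  have h2 : P (cls a, cls b) (cnt cls S') := by
    refine hd _ _ (hP _ _ _ (fun x => ?_) h1)
    have := Finset.le_sup (f := d) (Finset.mem_univ (cls a, cls b))
    have := hSS' x
    simp only
    omega
  intro B hB haB hbB
  exact h2 B a b rfl rfl haB hbB fun x =>
    cnt_mono cls (Finset.insert_subset (hsub ha) (Finset.insert_subset (hsub hb) hB)) x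

/-- An isomorphism can be extended, if pairs are added only to pairs of blocks between which it
already maps many points. -/
theorem exists_extension_level [Finite X]
    (hcls : ∀ A B : Finset E, (∀ x, cnt cls A x = cnt cls B x) → SameType L A B) :
    ∃ d : ℕ, ∀ d' ≥ d, ∀ Γ Γ' : Finset (E × E), IsIsoGraph L Γ →
      Set.InjOn Prod.fst (Γ' : Set (E × E)) → Set.InjOn Prod.snd (Γ' : Set (E × E)) →
      (∀ x, cnt (Prod.map cls cls) Γ' x ≤ cnt (Prod.map cls cls) Γ x ∨
        d' ≤ cnt (Prod.map cls cls) Γ x) →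
      SameType L (Γ'.image Prod.fst) (Γ'.image Prod.snd) := by
  cases nonempty_fintype X
  -- Pairs are coloured by the two blocks they join; `P` collects the count vectors of isomorphism
  -- graphs.
  let P : (X × X → ℕ) → Prop := fun v =>
    ∃ Γ : Finset (E × E), IsIsoGraph L Γ ∧ ∀ x, cnt (Prod.map cls cls) Γ x = v x
  have hP : ∀ v w, v ≤ w → P w → P v := by
    rintro v w hvw ⟨Γ, hΓ, h⟩
    obtain ⟨Δ, hΔ, h'⟩ := exists_subset_cnt_eq (Prod.map cls cls) Γ v fun x => by
      rw [h]; exact hvw x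
    exact ⟨Δ, hΓ.mono hΔ, h'⟩
  obtain ⟨d, hd⟩ := exists_truncation_level P hP
  refine ⟨d, fun d' hd' Γ Γ' hΓ h1 h2 h => ?_⟩
  -- `Γ'` itself need not be an isomorphism, but some isomorphism `Δ` has the same count vector. Row
  -- and column sums (`f1`, `f2`) show that `Γ'` and `Δ` have domains of equal type and ranges of
  -- equal type.
  obtain ⟨Δ, hΔ, hc⟩ : P (cnt (Prod.map cls cls) Γ') := by
    refine hd _ (hP _ _ (fun x => ?_) ⟨Γ, hΓ, fun x => rfl⟩)
    have := h x
    simp only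
    omega
  have f1 : ∀ Δ : Finset (E × E), Set.InjOn Prod.fst (Δ : Set (E × E)) → ∀ x,
      cnt cls (Δ.image Prod.fst) x = ∑ y, cnt (Prod.map cls cls) Δ (x, y) := by
    intro Δ hΔ x
    unfold cnt
    rw [Finset.filter_image, Finset.card_image_of_injOn (hΔ.mono fun p hp => (Finset.mem_filter.1 hp).1)]
    rw [Finset.card_eq_sum_card_fiberwise (f := fun p => cls p.2) (t := Finset.univ) (by simp)]
    refine Finset.sum_congr rfl fun y _ => ?_
    rw [Finset.filter_filter]
    congr 1
    ext p
    simp [Prod.ext_iff]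
  have f2 : ∀ Δ : Finset (E × E), Set.InjOn Prod.snd (Δ : Set (E × E)) → ∀ y,
      cnt cls (Δ.image Prod.snd) y = ∑ x, cnt (Prod.map cls cls) Δ (x, y) := by
    intro Δ hΔ x
    unfold cnt
    rw [Finset.filter_image, Finset.card_image_of_injOn (hΔ.mono fun p hp => (Finset.mem_filter.1 hp).1)]
    rw [Finset.card_eq_sum_card_fiberwise (f := fun p => cls p.1) (t := Finset.univ) (by simp)]
    refine Finset.sum_congr rfl fun y _ => ?_
    rw [Finset.filter_filter]
    congr 1
    ext p
    simp [Prod.ext_iff, and_comm]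
  refine ((hcls _ _ fun x => ?_).trans hΔ.sameType).trans (hcls _ _ fun x => ?_)
  · rw [f1 _ h1, f1 _ fun p hp q hq hpq => Prod.ext hpq ((hΔ.1 p hp q hq).1 hpq)]
    simp only [hc]
  · rw [f2 _ h2, f2 _ fun p hp q hq hpq => Prod.ext ((hΔ.1 p hp q hq).2 hpq) hpq]
    simp only [hc]

end Levels

end MonoDec

namespace MonoDec

open FirstOrder Classical

/-! ### Canonical blocks of finite subsets -/

section Blocks

variable (L : FirstOrder.Language.{u, v}) [L.IsRelational] {E : Type w} [L.Structure E]

/-- The exchangeability class of `a` in `S`. -/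
noncomputable def block (S : Finset E) (a : E) : Finset E := S.filter (ExchIn L S a)

/-- The exchangeability classes of `S`. -/
noncomputable def blocks (S : Finset E) : Finset (Finset E) := S.image (block L S)

/-- The sizes of the exchangeability classes of `S`. -/
noncomputable def sizes (S : Finset E) : Multiset ℕ := (blocks L S).val.map Finset.card

variable {L} {S T : Finset E} {a b : E}

theorem mem_block : b ∈ block L S a ↔ b ∈ S ∧ ExchIn L S a b := Finset.mem_filter

theorem block_eq_block (ha : a ∈ S) (hb : b ∈ S) :
    block L S a = block L S b ↔ ExchIn L S a b := by
  constructor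
  · intro h
    have : b ∈ block L S a := by rw [h]; exact mem_block.2 ⟨hb, ExchIn.refl S b⟩
    exact (mem_block.1 this).2
  · intro h
    ext c
    simp only [mem_block]
    exact and_congr_right fun hc => h.congr_left ha hb hc

theorem mem_blocks {C : Finset E} : C ∈ blocks L S ↔ ∃ a ∈ S, block L S a = C := Finset.mem_image

theorem block_mem_blocks (ha : a ∈ S) : block L S a ∈ blocks L S := Finset.mem_image_of_mem _ ha

theorem block_eq_of_mem {C : Finset E} (hC : C ∈ blocks L S) (ha : a ∈ C) :
    a ∈ S ∧ block L S a = C := by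
  obtain ⟨b, hb, rfl⟩ := mem_blocks.1 hC
  obtain ⟨h1, h2⟩ := mem_block.1 ha
  exact ⟨h1, ((block_eq_block hb h1).2 h2).symm⟩

theorem sum_sizes (S : Finset E) : (sizes L S).sum = S.card := by
  rw [Finset.card_eq_sum_card_image (block L S) S]
  refine Finset.sum_congr rfl fun C hC => ?_
  obtain ⟨a, ha, rfl⟩ := mem_blocks.1 hC
  congr 1
  ext b
  rw [mem_block, Finset.mem_filter]
  refine and_congr_right fun hb => ?_
  rw [eq_comm, block_eq_block ha hb]

/-- `Γ` is a correspondence of representatives that matches the classes of `S` and `T` bijectively.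
It is used for isomorphisms with `g = id` and for enlargements with `g = bump u`. -/
theorem sizes_eq_map (g : ℕ → ℕ) (Γ : Finset (E × E)) (hΓ : ∀ p ∈ Γ, p.1 ∈ S ∧ p.2 ∈ T)
    (h1 : ∀ a ∈ S, ∃ p ∈ Γ, p.1 = a) (h2 : ∀ b ∈ T, ∃ p ∈ Γ, ExchIn L T p.2 b)
    (h : ∀ p ∈ Γ, ∀ q ∈ Γ, ExchIn L S p.1 q.1 ↔ ExchIn L T p.2 q.2)
    (hg : ∀ p ∈ Γ, (block L T p.2).card = g (block L S p.1).card) :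
    sizes L T = (sizes L S).map g := by
  have hrep : ∀ C ∈ blocks L S, ∃ p ∈ Γ, block L S p.1 = C := by
    intro C hC
    obtain ⟨a, ha, rfl⟩ := mem_blocks.1 hC
    obtain ⟨p, hp, rfl⟩ := h1 a ha
    exact ⟨p, hp, rfl⟩
  choose p hp hpC using hrep
  unfold sizes
  rw [Multiset.map_map]
  symm
  refine Multiset.map_eq_map_of_bij_of_nodup _ _ (blocks L S).nodup (blocks L T).nodup
    (fun C hC => block L T (p C hC).2) ?_ ?_ ?_ ?_
  · intro C hC
    exact block_mem_blocks (hΓ _ (hp C hC)).2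
  · intro C hC C' hC' heq
    rw [block_eq_block (hΓ _ (hp C hC)).2 (hΓ _ (hp C' hC')).2, ← h _ (hp C hC) _ (hp C' hC'),
      ← block_eq_block (hΓ _ (hp C hC)).1 (hΓ _ (hp C' hC')).1, hpC, hpC] at heq
    exact heq
  · intro C hC
    obtain ⟨b, hb, rfl⟩ := mem_blocks.1 (show C ∈ blocks L T from hC)
    obtain ⟨q, hq, hqb⟩ := h2 b hb
    have hq' := hΓ q hq
    refine ⟨block L S q.1, block_mem_blocks hq'.1, ?_⟩
    have hm := block_mem_blocks (L := L) hq'.1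
    rw [block_eq_block (hΓ _ (hp _ hm)).2 hb]
    refine ExchIn.trans ?_ hqb (hΓ _ (hp _ hm)).2 hb
    rw [← h _ (hp _ hm) _ hq, ← block_eq_block (hΓ _ (hp _ hm)).1 hq'.1]
    exact hpC _ hm
  · intro C hC
    simp only [Function.comp]
    rw [hg _ (hp C hC), hpC]

theorem IsIsoGraph.card_block {Γ : Finset (E × E)} (hΓ : IsIsoGraph L Γ) {p : E × E}
    (hp : p ∈ Γ) :
    (block L (Γ.image Prod.snd) p.2).card = (block L (Γ.image Prod.fst) p.1).card := by
  have h1 : block L (Γ.image Prod.fst) p.1 =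
      (Γ.filter fun q => ExchIn L (Γ.image Prod.fst) p.1 q.1).image Prod.fst := by
    unfold block
    rw [Finset.filter_image]
  have h2 : block L (Γ.image Prod.snd) p.2 =
      (Γ.filter fun q => ExchIn L (Γ.image Prod.fst) p.1 q.1).image Prod.snd := by
    unfold block
    rw [Finset.filter_image]
    congr 1
    exact Finset.filter_congr fun q hq => (hΓ.exchIn_iff hp hq).symm
  have h3 := hΓ.mono (Finset.filter_subset (fun q => ExchIn L (Γ.image Prod.fst) p.1 q.1) Γ)
  rw [h1, h2, h3.card_fst, h3.card_snd]

theorem SameType.sizes_eq (h : SameType L S T) : sizes L S = sizes L T := by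
  obtain ⟨Γ, hΓ, rfl, rfl⟩ := h.exists_isIsoGraph
  have := sizes_eq_map (L := L) id Γ
    (fun p hp => ⟨Finset.mem_image_of_mem _ hp, Finset.mem_image_of_mem _ hp⟩)
    (fun a ha => Finset.mem_image.1 ha)
    (fun b hb => by
      obtain ⟨p, hp, rfl⟩ := Finset.mem_image.1 hb
      exact ⟨p, hp, ExchIn.refl _ _⟩)
    (fun p hp q hq => hΓ.exchIn_iff hp hq) (fun p hp => hΓ.card_block hp)
  rw [this, Multiset.map_id]

end Blocks

/-! ### Enlarging the large blocks -/

section Up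

variable (L : FirstOrder.Language.{u, v}) [L.IsRelational] {E : Type w} [L.Structure E]
  {X : Type*}

/-- A number of points of a block that is large enough for new points of this block to be added
without affecting exchangeability and isomorphisms. -/
structure IsLevel (cls : E → X) (d : ℕ) : Prop where
  pos : 0 < d
  hcls : ∀ A B : Finset E, (∀ x, cnt cls A x = cnt cls B x) → SameType L A B
  exch : ∀ S S' : Finset E, S ⊆ S' → (∀ x, cnt cls S' x ≤ cnt cls S x ∨ d ≤ cnt cls S x) →
    ∀ a ∈ S, ∀ b ∈ S, ExchIn L S a b → ExchIn L S' a b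
  ext : ∀ Γ Γ' : Finset (E × E), IsIsoGraph L Γ →
    Set.InjOn Prod.fst (Γ' : Set (E × E)) → Set.InjOn Prod.snd (Γ' : Set (E × E)) →
    (∀ x, cnt (Prod.map cls cls) Γ' x ≤ cnt (Prod.map cls cls) Γ x ∨
      d ≤ cnt (Prod.map cls cls) Γ x) →
    SameType L (Γ'.image Prod.fst) (Γ'.image Prod.snd)
  inf : ∀ (S : Finset E) (x : X), d ≤ cnt cls S x → (cls ⁻¹' {x}).Infinite

variable {L} {cls : E → X} {d : ℕ}

theorem exists_isLevel [Finite X]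
    (hcls : ∀ A B : Finset E, (∀ x, cnt cls A x = cnt cls B x) → SameType L A B) :
    ∃ d, IsLevel L cls d := by
  cases nonempty_fintype X
  obtain ⟨d1, h1⟩ := exists_exchIn_level hcls
  obtain ⟨d2, h2⟩ := exists_extension_level hcls
  -- The supremum exceeds the size of every finite block, since `ncard` is `0` on infinite ones;
  -- adding `1` makes `inf` strict and the level positive.
  refine ⟨d1 + d2 + (Finset.univ.sup fun x => (cls ⁻¹' {x}).ncard) + 1, ⟨by omega, hcls,
    h1 _ (by omega), h2 _ (by omega), fun S x hx => ?_⟩⟩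
  by_contra hcon
  rw [Set.not_infinite] at hcon
  have h3 : cnt cls S x ≤ (cls ⁻¹' {x}).ncard := by
    rw [cnt, ← Set.ncard_coe_finset]
    refine Set.ncard_le_ncard (fun a ha => ?_) hcon
    exact (Finset.mem_filter.1 ha).2
  have h4 := Finset.le_sup (f := fun x => (cls ⁻¹' {x}).ncard) (Finset.mem_univ x)
  omega

theorem exists_mem_of_cnt_pos {S : Finset E} {x : X} (h : 0 < cnt cls S x) :
    ∃ a ∈ S, cls a = x := by
  obtain ⟨a, ha⟩ := Finset.card_pos.1 h
  exact ⟨a, Finset.mem_filter.1 ha⟩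

theorem cnt_le_of_forall_notMem {α : Type*} (c : α → X) {S S' : Finset α} {x : X}
    (h : ∀ z ∈ S', z ∉ S → c z ≠ x) : cnt c S' x ≤ cnt c S x := by
  refine Finset.card_le_card fun z hz => ?_
  obtain ⟨hz1, hz2⟩ := Finset.mem_filter.1 hz
  refine Finset.mem_filter.2 ⟨?_, hz2⟩
  by_contra hcon
  exact h z hz1 hcon hz2

theorem IsLevel.exchIn_iff (hd : IsLevel L cls d) {S S' : Finset E} (hS : S ⊆ S')
    (h : ∀ z ∈ S', z ∉ S → d ≤ cnt cls S (cls z)) {a b : E} (ha : a ∈ S) (hb : b ∈ S) :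
    ExchIn L S' a b ↔ ExchIn L S a b := by
  refine ⟨fun h => h.mono hS, fun hab => hd.exch S S' hS (fun x => ?_) a ha b hb hab⟩
  by_cases hx : ∃ z ∈ S', z ∉ S ∧ cls z = x
  · obtain ⟨z, hz, hzS, rfl⟩ := hx
    exact Or.inr (h z hz hzS)
  · push Not at hx
    exact Or.inl (cnt_le_of_forall_notMem cls hx)

/-- A new point shares its block of `E` with an old point, so an enlargement creates no new
exchangeability class. -/
theorem IsLevel.exists_exchIn (hd : IsLevel L cls d) {S S' : Finset E}
    (h : ∀ z ∈ S', z ∉ S → d ≤ cnt cls S (cls z)) {z : E} (hz : z ∈ S') (W : Finset E) :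
    ∃ a ∈ S, ExchIn L W a z := by
  by_cases hzS : z ∈ S
  · exact ⟨z, hzS, ExchIn.refl _ _⟩
  · obtain ⟨a, ha, haz⟩ := exists_mem_of_cnt_pos (hd.pos.trans_le (h z hz hzS))
    exact ⟨a, ha, exchIn_of_cls_eq hd.hcls haz _⟩

variable (L cls d) in
/-- `S'` arises from `S` by adding one point to every exchangeability class of size at
least `u`. -/
structure Up (u : ℕ) (S S' : Finset E) : Prop where
  sub : S ⊆ S'
  large : ∀ z ∈ S', z ∉ S → d ≤ cnt cls S (cls z)
  card : ∀ a ∈ S, ((S' \ S).filter (ExchIn L S' a)).card = if u ≤ (block L S a).card then 1 else 0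

/-- Raise the numbers that are at least `u` by one. -/
def bump (u s : ℕ) : ℕ := if u ≤ s then s + 1 else s

theorem filter_exchIn_eq_block (hd : IsLevel L cls d) {S S' : Finset E} (hS : S ⊆ S')
    (h : ∀ z ∈ S', z ∉ S → d ≤ cnt cls S (cls z)) {a : E} (ha : a ∈ S) :
    S.filter (ExchIn L S' a) = block L S a :=
  Finset.filter_congr fun _ hb => hd.exchIn_iff hS h ha hb

theorem card_block_eq_add (hd : IsLevel L cls d) {S S' : Finset E} (hS : S ⊆ S')
    (h : ∀ z ∈ S', z ∉ S → d ≤ cnt cls S (cls z)) {a : E} (ha : a ∈ S) :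
    (block L S' a).card = (block L S a).card + ((S' \ S).filter (ExchIn L S' a)).card := by
  rw [← filter_exchIn_eq_block hd hS h ha, ← Finset.card_union_of_disjoint
    (Finset.disjoint_filter_filter Finset.disjoint_sdiff), ← Finset.filter_union,
    Finset.union_sdiff_of_subset hS, block]

variable {u : ℕ} {S S' T T' : Finset E}

theorem Up.card_block (hd : IsLevel L cls d) (h : Up L cls d u S S') {a : E} (ha : a ∈ S) :
    (block L S' a).card = bump u (block L S a).card := by
  rw [card_block_eq_add hd h.sub h.large ha, h.card a ha, bump]
  split_ifs <;> rfl

theorem Up.sizes_eq (hd : IsLevel L cls d) (h : Up L cls d u S S') :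
    sizes L S' = (sizes L S).map (bump u) := by
  refine sizes_eq_map _ (S.image fun a => (a, a)) ?_ ?_ ?_ ?_ ?_
  · intro p hp
    obtain ⟨a, ha, rfl⟩ := Finset.mem_image.1 hp
    exact ⟨ha, h.sub ha⟩
  · intro a ha
    exact ⟨_, Finset.mem_image_of_mem _ ha, rfl⟩
  · intro b hb
    obtain ⟨a, ha, hab⟩ := hd.exists_exchIn h.large hb S'
    exact ⟨_, Finset.mem_image_of_mem _ ha, hab⟩
  · intro p hp q hq
    obtain ⟨a, ha, rfl⟩ := Finset.mem_image.1 hp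
    obtain ⟨b, hb, rfl⟩ := Finset.mem_image.1 hq
    exact (hd.exchIn_iff h.sub h.large ha hb).symm
  · intro p hp
    obtain ⟨a, ha, rfl⟩ := Finset.mem_image.1 hp
    exact h.card_block hd ha

/-- The threshold matters only through the set of classes that reach it. -/
theorem Up.congr_level {u' : ℕ} (h : Up L cls d u S S')
    (hu : ∀ s ∈ sizes L S, u ≤ s ↔ u' ≤ s) : Up L cls d u' S S' := by
  refine ⟨h.sub, h.large, fun a ha => ?_⟩
  rw [h.card a ha]
  exact if_congr (hu _ (Multiset.mem_map_of_mem _ (block_mem_blocks ha))) rfl rfl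

/-- Both enlargements are compared inside `S' ∪ T'`. Each exchangeability class there contains an
old point `a` and meets both sets in `bump u` of the size of the class of `a` in `S`. -/
theorem Up.sameType (hd : IsLevel L cls d) (h : Up L cls d u S S') (h' : Up L cls d u S T') :
    SameType L S' T' := by
  have hl : ∀ z ∈ S' ∪ T', z ∉ S → d ≤ cnt cls S (cls z) := by
    intro z hz hzS
    rcases Finset.mem_union.1 hz with hz | hz
    · exact h.large z hz hzS
    · exact h'.large z hz hzS
  have key : ∀ V, Up L cls d u S V → V ⊆ S' ∪ T' → ∀ a ∈ S,
      (V.filter (ExchIn L (S' ∪ T') a)).card = bump u (block L S a).card := by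
    intro V hV hVW a ha
    rw [filter_exchIn_eq_block hd hVW (fun z hz hzV =>
      (hl z hz fun hzS => hzV (hV.sub hzS)).trans (cnt_mono cls hV.sub _)) (hV.sub ha),
      hV.card_block hd ha]
  refine sameType_of_exchIn (S' ∪ T') _ _ Finset.subset_union_left Finset.subset_union_right
    fun s hs => ?_
  obtain ⟨a, ha, has⟩ := hd.exists_exchIn hl hs (S' ∪ T')
  have haW : a ∈ S' ∪ T' := Finset.mem_union_left _ (h.sub ha)
  have e : ∀ V ⊆ S' ∪ T', V.filter (ExchIn L (S' ∪ T') s) = V.filter (ExchIn L (S' ∪ T') a) :=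
    fun V hV => Finset.filter_congr fun b hb => (has.congr_left haW hs (hV hb)).symm
  rw [e _ Finset.subset_union_left, e _ Finset.subset_union_right,
    key S' h Finset.subset_union_left a ha, key T' h' Finset.subset_union_right a ha]

/-- The `p i` represent the classes of size at least `u`, once each, and `z i` is a new point from
the block of `p i`, hence exchangeable with it. -/
theorem up_of_family {ι : Type*} [Fintype ι] (hd : IsLevel L cls d) (z p : ι → E)
    (hp : ∀ i, p i ∈ S) (hz : ∀ i, z i ∉ S) (hzp : ∀ i, cls (z i) = cls (p i))
    (hl : ∀ i, d ≤ cnt cls S (cls (p i)))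
    (hu : ∀ a ∈ S, u ≤ (block L S a).card ↔ ∃ i, ExchIn L S a (p i))
    (hi : ∀ i j, ExchIn L S (p i) (p j) → i = j) :
    Up L cls d u S (S ∪ Finset.univ.image z) := by
  have hlarge : ∀ y ∈ S ∪ Finset.univ.image z, y ∉ S → d ≤ cnt cls S (cls y) := by
    intro y hy hyS
    obtain ⟨i, -, rfl⟩ := Finset.mem_image.1 ((Finset.mem_union.1 hy).resolve_left hyS)
    rw [hzp]; exact hl i
  have hsub : S ⊆ S ∪ Finset.univ.image z := Finset.subset_union_left
  refine ⟨hsub, hlarge, fun a ha => ?_⟩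
  have hiff : ∀ i, ExchIn L (S ∪ Finset.univ.image z) a (z i) ↔ ExchIn L S a (p i) := by
    intro i
    rw [← hd.exchIn_iff hsub hlarge ha (hp i)]
    have h1 := exchIn_of_cls_eq hd.hcls (hzp i) (S ∪ Finset.univ.image z)
    have hm : z i ∈ S ∪ Finset.univ.image z := by simp
    exact ⟨fun h => h.trans h1 (hsub ha) (hsub (hp i)),
      fun h => h.trans h1.symm (hsub ha) hm⟩
  have hsd : (S ∪ Finset.univ.image z) \ S = Finset.univ.image z := by
    rw [Finset.union_sdiff_left, Finset.sdiff_eq_self_iff_disjoint, Finset.disjoint_left]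
    intro y hy
    obtain ⟨i, -, rfl⟩ := Finset.mem_image.1 hy
    exact hz i
  rw [hsd]
  split_ifs with h
  · obtain ⟨i, hi'⟩ := (hu a ha).1 h
    rw [Finset.card_eq_one]
    refine ⟨z i, ?_⟩
    ext y
    simp only [Finset.mem_filter, Finset.mem_image, Finset.mem_univ, true_and,
      Finset.mem_singleton]
    constructor
    · rintro ⟨⟨j, rfl⟩, hj⟩
      rw [hi i j (hi'.symm.trans ((hiff j).1 hj) (hp i) (hp j))]
    · rintro rfl
      exact ⟨⟨i, rfl⟩, (hiff i).2 hi'⟩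
  · rw [Finset.card_eq_zero, Finset.filter_eq_empty_iff]
    intro y hy hay
    obtain ⟨i, -, rfl⟩ := Finset.mem_image.1 hy
    exact h ((hu a ha).2 ⟨i, (hiff i).1 hay⟩)

/-- Above each class of size at least `u` the pairs of `Γ` have at most `|X × X|` colours, so some
colour occurs at least `d` times. Adding one new pair of this colour per class enlarges domain and
range together, and the level guarantees that they stay isomorphic. -/
theorem exists_up_of_isIsoGraph [Fintype X] (hd : IsLevel L cls d)
    (hu : Fintype.card (X × X) * d ≤ u) {Γ : Finset (E × E)} (hΓ : IsIsoGraph L Γ) :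
    ∃ S' T', Up L cls d u (Γ.image Prod.fst) S' ∧ Up L cls d u (Γ.image Prod.snd) T' ∧
      SameType L S' T' := by
  set S := Γ.image Prod.fst with hS
  set T := Γ.image Prod.snd with hT
  have memS : ∀ {p}, p ∈ Γ → p.1 ∈ S := fun hp => Finset.mem_image_of_mem _ hp
  have memT : ∀ {p}, p ∈ Γ → p.2 ∈ T := fun hp => Finset.mem_image_of_mem _ hp
  have cS : ∀ p : E × E, cnt (Prod.map cls cls) Γ (Prod.map cls cls p) ≤ cnt cls S (cls p.1) := by
    intro p
    obtain ⟨Δ, hΔ, hc, hx⟩ := exists_card_eq_cnt (Prod.map cls cls) Γ (Prod.map cls cls p)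
    rw [← hc, ← (hΓ.mono hΔ).card_fst]
    refine Finset.card_le_card fun a ha => ?_
    obtain ⟨q, hq, rfl⟩ := Finset.mem_image.1 ha
    exact Finset.mem_filter.2 ⟨memS (hΔ hq), (Prod.ext_iff.1 (hx q hq)).1⟩
  have cT : ∀ p : E × E, cnt (Prod.map cls cls) Γ (Prod.map cls cls p) ≤ cnt cls T (cls p.2) := by
    intro p
    obtain ⟨Δ, hΔ, hc, hx⟩ := exists_card_eq_cnt (Prod.map cls cls) Γ (Prod.map cls cls p)
    rw [← hc, ← (hΓ.mono hΔ).card_snd]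
    refine Finset.card_le_card fun a ha => ?_
    obtain ⟨q, hq, rfl⟩ := Finset.mem_image.1 ha
    exact Finset.mem_filter.2 ⟨memT (hΔ hq), (Prod.ext_iff.1 (hx q hq)).2⟩
  let 𝒞 := (blocks L S).filter fun C => u ≤ C.card
  have hpig : ∀ C : 𝒞, ∃ p ∈ Γ, block L S p.1 = C ∧
      d ≤ cnt (Prod.map cls cls) Γ (Prod.map cls cls p) := by
    rintro ⟨C, hC⟩
    obtain ⟨hC1, hC2⟩ := Finset.mem_filter.1 hC
    have hsub := hΓ.mono (Finset.filter_subset (fun p => p.1 ∈ C) Γ)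
    have himg : (Γ.filter fun p => p.1 ∈ C).image Prod.fst = C := by
      ext a
      simp only [Finset.mem_image, Finset.mem_filter]
      constructor
      · rintro ⟨p, ⟨_, hp⟩, rfl⟩
        exact hp
      · intro ha
        obtain ⟨p, hp, rfl⟩ := Finset.mem_image.1 (block_eq_of_mem hC1 ha).1
        exact ⟨p, ⟨hp, ha⟩, rfl⟩
    have hcard := hsub.card_fst
    rw [himg] at hcard
    obtain ⟨a, ha, -⟩ := mem_blocks.1 hC1
    obtain ⟨y, -, hy⟩ := Finset.exists_le_card_fiber_of_mul_le_card_of_maps_to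
      (s := Γ.filter fun p => p.1 ∈ C) (t := Finset.univ) (f := Prod.map cls cls) (n := d)
      (fun _ _ => Finset.mem_univ _) ⟨(cls a, cls a), Finset.mem_univ _⟩
      (by rw [← hcard]; exact hu.trans hC2)
    obtain ⟨p, hp⟩ := Finset.card_pos.1 (hd.pos.trans_le hy)
    obtain ⟨hp1, rfl⟩ := Finset.mem_filter.1 hp
    obtain ⟨hp1, hp2⟩ := Finset.mem_filter.1 hp1
    refine ⟨p, hp1, (block_eq_of_mem hC1 hp2).2, hy.trans ?_⟩
    rw [card_filter_eq_cnt]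
    exact cnt_mono (Prod.map cls cls) (Finset.filter_subset (fun p => p.1 ∈ C) Γ) _
  choose p hpΓ hpC hpd using hpig
  have hz : ∀ C : 𝒞, ∃ z : E × E, z.1 ∉ S ∧ z.2 ∉ T ∧
      Prod.map cls cls z = Prod.map cls cls (p C) := by
    intro C
    -- Blocks with `d` points in a finite set are infinite, so unused points are available.
    obtain ⟨a, ha, haS⟩ := (hd.inf S _ ((hpd C).trans (cS _))).exists_notMem_finset S
    obtain ⟨b, hb, hbT⟩ := (hd.inf T _ ((hpd C).trans (cT _))).exists_notMem_finset T
    exact ⟨(a, b), haS, hbT, Prod.ext ha hb⟩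
  choose z hzS hzT hzp using hz
  have hzp1 : ∀ C, cls (z C).1 = cls (p C).1 := fun C => (Prod.ext_iff.1 (hzp C)).1
  have hzp2 : ∀ C, cls (z C).2 = cls (p C).2 := fun C => (Prod.ext_iff.1 (hzp C)).2
  have hinj1 : ∀ C D, ExchIn L S (p C).1 (p D).1 → C = D := by
    intro C D h
    rw [← block_eq_block (memS (hpΓ C)) (memS (hpΓ D)), hpC, hpC] at h
    exact Subtype.ext h
  have hinj2 : ∀ C D, ExchIn L T (p C).2 (p D).2 → C = D := fun C D h =>
    hinj1 C D ((hΓ.exchIn_iff (hpΓ C) (hpΓ D)).2 h)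
  have hu1 : ∀ a ∈ S, u ≤ (block L S a).card ↔ ∃ C, ExchIn L S a (p C).1 := by
    intro a ha
    constructor
    · intro h
      refine ⟨⟨block L S a, Finset.mem_filter.2 ⟨block_mem_blocks ha, h⟩⟩, ?_⟩
      rw [← block_eq_block ha (memS (hpΓ _)), hpC]
    · rintro ⟨C, hC⟩
      rw [← block_eq_block ha (memS (hpΓ _)), hpC] at hC
      rw [hC]
      exact (Finset.mem_filter.1 C.2).2
  have hu2 : ∀ b ∈ T, u ≤ (block L T b).card ↔ ∃ C, ExchIn L T b (p C).2 := by
    intro b hb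
    obtain ⟨q, hq, rfl⟩ := Finset.mem_image.1 hb
    rw [hΓ.card_block hq, hu1 _ (memS hq)]
    exact exists_congr fun C => hΓ.exchIn_iff hq (hpΓ C)
  refine ⟨_, _, up_of_family hd (fun C => (z C).1) (fun C => (p C).1) (fun C => memS (hpΓ C)) hzS
    hzp1 (fun C => (hpd C).trans (cS _)) hu1 hinj1,
    up_of_family hd (fun C => (z C).2) (fun C => (p C).2) (fun C => memT (hpΓ C)) hzT
    hzp2 (fun C => (hpd C).trans (cT _)) hu2 hinj2, ?_⟩
  have e1 : S ∪ Finset.univ.image (fun C => (z C).1) = (Γ ∪ Finset.univ.image z).image Prod.fst := by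
    rw [Finset.image_union, Finset.image_image]; rfl
  have e2 : T ∪ Finset.univ.image (fun C => (z C).2) = (Γ ∪ Finset.univ.image z).image Prod.snd := by
    rw [Finset.image_union, Finset.image_image]; rfl
  rw [e1, e2]
  refine hd.ext Γ _ hΓ ?_ ?_ ?_
  · intro q hq r hr hqr
    rw [Finset.mem_coe, Finset.mem_union, Finset.mem_image] at hq hr
    rcases hq with hq | ⟨C, -, rfl⟩ <;> rcases hr with hr | ⟨D, -, rfl⟩
    · exact Prod.ext hqr ((hΓ.1 q hq r hr).1 hqr)
    · exact absurd (hqr ▸ memS hq) (hzS D)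
    · exact absurd (hqr ▸ memS hr) (hzS C)
    · rw [hinj1 C D (exchIn_of_cls_eq hd.hcls (by rw [← hzp1, ← hzp1, hqr]) S)]
  · intro q hq r hr hqr
    rw [Finset.mem_coe, Finset.mem_union, Finset.mem_image] at hq hr
    rcases hq with hq | ⟨C, -, rfl⟩ <;> rcases hr with hr | ⟨D, -, rfl⟩
    · exact Prod.ext ((hΓ.1 q hq r hr).2 hqr) hqr
    · exact absurd (hqr ▸ memT hq) (hzT D)
    · exact absurd (hqr ▸ memT hr) (hzT C)
    · rw [hinj2 C D (exchIn_of_cls_eq hd.hcls (by rw [← hzp2, ← hzp2, hqr]) T)]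
  · intro x
    by_cases hx : ∃ C, Prod.map cls cls (z C) = x
    · obtain ⟨C, rfl⟩ := hx
      rw [hzp]
      exact Or.inr (hpd C)
    · push Not at hx
      refine Or.inl (cnt_le_of_forall_notMem _ fun q hq hqΓ => ?_)
      obtain ⟨C, -, rfl⟩ := Finset.mem_image.1 ((Finset.mem_union.1 hq).resolve_left hqΓ)
      exact hx C

theorem SameType.up [Fintype X] (hd : IsLevel L cls d) (hu : Fintype.card (X × X) * d ≤ u)
    (hST : SameType L S T) (hS : Up L cls d u S S') (hT : Up L cls d u T T') :
    SameType L S' T' := by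
  obtain ⟨Γ, hΓ, rfl, rfl⟩ := hST.exists_isIsoGraph
  obtain ⟨S'', T'', h1, h2, h⟩ := exists_up_of_isIsoGraph hd hu hΓ
  exact ((hS.sameType hd h1).trans h).trans (h2.sameType hd hT)

theorem exists_up [Fintype X] (hd : IsLevel L cls d) (hu : Fintype.card (X × X) * d ≤ u)
    (S : Finset E) : ∃ S', Up L cls d u S S' := by
  obtain ⟨S', -, h, -⟩ := exists_up_of_isIsoGraph hd hu (isIsoGraph_diag (L := L) S)
  refine ⟨S', ?_⟩
  rw [Finset.image_image] at h
  simpa [Function.comp_def] using h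

/-- Pigeonhole over the blocks. The strict inequality leaves `d` points after one is removed. -/
theorem exists_large_class [Fintype X] (hu : Fintype.card X * d < u) {C : Finset E}
    (hC : u ≤ C.card) : ∃ z ∈ C, d < cnt cls C (cls z) := by
  obtain ⟨y, -, hy⟩ := Finset.exists_lt_card_fiber_of_mul_lt_card_of_maps_to
    (s := C) (t := Finset.univ) (f := cls) (n := d) (fun _ _ => Finset.mem_univ _)
    (hu.trans_le hC)
  obtain ⟨z, hz, rfl⟩ := exists_mem_of_cnt_pos (Nat.zero_le d |>.trans_lt hy)
  exact ⟨z, hz, hy⟩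

/-- Remove one point from every class of size above `u`, taken from a block of `E` with more than
`d` points in `S'`. A class of size exactly `u` would keep its size and wrongly count as enlarged by
`Up`, so it has to be excluded. -/
theorem exists_down [Fintype X] (hd : IsLevel L cls d) (hu : Fintype.card X * d < u + 1)
    (hS' : u ∉ sizes L S') : ∃ S, Up L cls d u S S' := by
  let 𝒞 := (blocks L S').filter fun C => u + 1 ≤ C.card
  have hz : ∀ C : 𝒞, ∃ z ∈ S', block L S' z = C ∧ d < cnt cls S' (cls z) := by
    rintro ⟨C, hC⟩
    obtain ⟨hC1, hC2⟩ := Finset.mem_filter.1 hC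
    obtain ⟨z, hz, hz'⟩ := exists_large_class (cls := cls) hu hC2
    obtain ⟨h1, h2⟩ := block_eq_of_mem hC1 hz
    refine ⟨z, h1, h2, hz'.trans_le (cnt_mono _ (fun a ha => (block_eq_of_mem hC1 ha).1) _)⟩
  choose z hzS hzC hzd using hz
  have hinj : ∀ C D, ExchIn L S' (z C) (z D) → C = D := by
    intro C D h
    rw [← block_eq_block (hzS C) (hzS D), hzC, hzC] at h
    exact Subtype.ext h
  set Z := Finset.univ.image z with hZdef
  have hZ : Z ⊆ S' := by
    intro a ha
    obtain ⟨C, -, rfl⟩ := Finset.mem_image.1 ha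
    exact hzS C
  have hsub : S' \ Z ⊆ S' := Finset.sdiff_subset
  have hsd : S' \ (S' \ Z) = Z := by
    rw [Finset.sdiff_sdiff_eq_self hZ]
  have hlarge : ∀ y ∈ S', y ∉ S' \ Z → d ≤ cnt cls (S' \ Z) (cls y) := by
    intro y hy hyS
    have hyZ : y ∈ Z := by
      rw [← hsd]; exact Finset.mem_sdiff.2 ⟨hy, hyS⟩
    obtain ⟨C, -, rfl⟩ := Finset.mem_image.1 hyZ
    -- Points of one block are exchangeable and only one point per class is removed, so each block
    -- loses at most one point.
    have h1 : cnt cls Z (cls (z C)) ≤ 1 := by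
      rw [cnt, Finset.card_le_one]
      have key : ∀ a ∈ Z.filter fun a => cls a = cls (z C), a = z C := by
        intro a ha
        obtain ⟨haZ, hac⟩ := Finset.mem_filter.1 ha
        obtain ⟨D, -, rfl⟩ := Finset.mem_image.1 haZ
        rw [hinj D C (exchIn_of_cls_eq hd.hcls hac _)]
      intro a ha b hb
      rw [key a ha, key b hb]
    have h2 := cnt_union cls (Finset.sdiff_disjoint (t := S') (s := Z)) (cls (z C))
    rw [Finset.sdiff_union_of_subset hZ] at h2
    have h3 := hzd C
    omega
  refine ⟨S' \ Z, hsub, hlarge, fun a ha => ?_⟩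
  have haS := hsub ha
  have hcard := card_block_eq_add hd hsub hlarge ha
  have hne : (block L S' a).card ≠ u := fun h =>
    hS' (h ▸ Multiset.mem_map_of_mem _ (block_mem_blocks haS))
  rw [hsd] at hcard ⊢
  by_cases h : u + 1 ≤ (block L S' a).card
  · have h1 : (Z.filter (ExchIn L S' a)).card = 1 := by
      let C : 𝒞 := ⟨block L S' a, Finset.mem_filter.2 ⟨block_mem_blocks haS, h⟩⟩
      have hC : ExchIn L S' a (z C) := by
        rw [← block_eq_block haS (hzS C), hzC]
      rw [Finset.card_eq_one]
      refine ⟨z C, ?_⟩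
      ext y
      simp only [Finset.mem_filter, Finset.mem_singleton]
      constructor
      · rintro ⟨hy, hay⟩
        obtain ⟨D, -, rfl⟩ := Finset.mem_image.1 hy
        rw [hinj D C (hay.symm.trans hC (hzS D) (hzS C))]
      · rintro rfl
        exact ⟨Finset.mem_image_of_mem _ (Finset.mem_univ _), hC⟩
    rw [h1] at hcard ⊢
    rw [if_pos (by omega)]
  · have h1 : (Z.filter (ExchIn L S' a)).card = 0 := by
      rw [Finset.card_eq_zero, Finset.filter_eq_empty_iff]
      intro y hy hay
      obtain ⟨C, -, rfl⟩ := Finset.mem_image.1 hy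
      rw [← block_eq_block haS (hzS C), hzC] at hay
      rw [hay] at h
      exact h (Finset.mem_filter.1 C.2).2
    rw [h1] at hcard ⊢
    rw [if_neg (by omega)]

/-- `bump u` is injective and omits the value `u`, so the size of a class of `S'` determines the
size of its trace on `S`. -/
theorem Up.card_filter (hd : IsLevel L cls d) (h : Up L cls d u S S') {s : E} (hs : s ∈ S') :
    (S.filter (ExchIn L S' s)).card =
      if u < (block L S' s).card then (block L S' s).card - 1 else (block L S' s).card := by
  obtain ⟨a, ha, has⟩ := hd.exists_exchIn h.large hs S'
  rw [← (block_eq_block (h.sub ha) hs).2 has, h.card_block hd ha,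
    Finset.filter_congr fun b hb => (has.congr_left (h.sub ha) hs (h.sub hb)).symm,
    filter_exchIn_eq_block hd h.sub h.large ha, bump]
  split_ifs <;> omega

/-- By `Up.card_filter`, the image of `S` under an isomorphism and the set `T` meet every class of
`T'` in the same number of points. The isomorphism itself need not carry `S` to `T`. -/
theorem SameType.down (hd : IsLevel L cls d)
    (hST : SameType L S' T') (hS : Up L cls d u S S') (hT : Up L cls d u T T') :
    SameType L S T := by
  obtain ⟨Γ, hΓ, rfl, rfl⟩ := hST.exists_isIsoGraph
  have hΔ := hΓ.mono (Finset.filter_subset (fun p => p.1 ∈ S) Γ)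
  have himg : (Γ.filter fun p => p.1 ∈ S).image Prod.fst = S := by
    ext a
    simp only [Finset.mem_image, Finset.mem_filter]
    constructor
    · rintro ⟨p, ⟨_, hp⟩, rfl⟩
      exact hp
    · intro ha
      obtain ⟨p, hp, rfl⟩ := Finset.mem_image.1 (hS.sub ha)
      exact ⟨p, ⟨hp, ha⟩, rfl⟩
  have h1 := hΔ.sameType
  rw [himg] at h1
  refine h1.trans (sameType_of_exchIn (Γ.image Prod.snd) _ _
    (Finset.image_subset_image (Finset.filter_subset _ _)) hT.sub fun s hs => ?_)
  rw [hT.card_filter hd hs]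
  obtain ⟨p, hp, rfl⟩ := Finset.mem_image.1 hs
  rw [hΓ.card_block hp, ← hS.card_filter hd (Finset.mem_image_of_mem _ hp), Finset.filter_image,
    (hΔ.mono (Finset.filter_subset _ _)).card_snd]
  conv_rhs => rw [← himg]
  rw [Finset.filter_image, (hΔ.mono (Finset.filter_subset _ _)).card_fst]
  congr 1
  refine Finset.filter_congr fun q hq => ?_
  exact (hΓ.exchIn_iff hp (Finset.mem_filter.1 hq).1).symm

end Up

end MonoDec

namespace MonoDec

open FirstOrder Classical

/-! ### Gaps in a multiset of natural numbers -/

section Gaps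

/-- The number of members of `M` that are at least `t`. -/
def numGE (M : Multiset ℕ) (t : ℕ) : ℕ := M.countP (t ≤ ·)

/-- The number of `t > D` such that exactly `i` members of `M` are at least `t`. -/
noncomputable def gap (D : ℕ) (M : Multiset ℕ) (i : ℕ) : ℕ := {t | D < t ∧ numGE M t = i}.ncard

/-- The sum of the members of `M`, truncated at `D`. -/
def low (D : ℕ) (M : Multiset ℕ) : ℕ := (M.map (min · D)).sum

variable {D u i : ℕ} {M : Multiset ℕ}

theorem numGE_anti (M : Multiset ℕ) : Antitone (numGE M) := fun _ _ h =>
  by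
  unfold numGE
  rw [Multiset.countP_eq_card_filter, Multiset.countP_eq_card_filter]
  exact Multiset.card_le_card (Multiset.monotone_filter_right _ fun _ h' => h.trans h')

theorem numGE_eq_zero {t : ℕ} (ht : M.sum < t) : numGE M t = 0 :=
  Multiset.countP_eq_zero.2 fun _ ha h =>
    absurd (Multiset.single_le_sum (fun _ _ => Nat.zero_le _) _ ha) (by omega)

theorem finite_gap (hi : i ≠ 0) : {t | D < t ∧ numGE M t = i}.Finite := by
  refine (Set.finite_Iic M.sum).subset fun t ht => ?_
  by_contra hcon
  exact hi (ht.2 ▸ numGE_eq_zero (not_le.1 hcon))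

/-- The members that are at least `u` and those at least `u'` are nested, so equal counts force
equality. -/
theorem le_iff_le_of_numGE_eq {u u' : ℕ} (h : numGE M u = numGE M u') :
    ∀ s ∈ M, u ≤ s ↔ u' ≤ s := by
  wlog huu : u ≤ u' generalizing u u'
  · exact fun s hs => (this h.symm (le_of_not_ge huu) s hs).symm
  intro s hs
  refine ⟨fun hus => ?_, fun h' => huu.trans h'⟩
  by_contra hcon
  obtain ⟨N, rfl⟩ := Multiset.exists_cons_of_mem hs
  have h1 : numGE (s ::ₘ N) u = numGE N u + 1 := Multiset.countP_cons_of_pos _ hus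
  have h2 : numGE (s ::ₘ N) u' = numGE N u' := Multiset.countP_cons_of_neg _ hcon
  have := numGE_anti N huu
  omega

/-- With `numGE M t` as the height of column `t`, bumping inserts a copy of column `u` right after
it. -/
theorem numGE_map_bump (t : ℕ) :
    numGE (M.map (bump u)) t = if t ≤ u then numGE M t else numGE M (t - 1) := by
  unfold numGE
  rw [Multiset.countP_map, ← Multiset.countP_eq_card_filter]
  split_ifs with h
  · refine Multiset.countP_congr rfl fun s _ => ?_
    unfold bump
    split_ifs <;> simp only [eq_iff_iff]
    omega
  · refine Multiset.countP_congr rfl fun s _ => ?_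
    unfold bump
    split_ifs <;> (simp only [eq_iff_iff]; omega)

theorem low_map_bump (hu : D ≤ u) : low D (M.map (bump u)) = low D M := by
  unfold low
  rw [Multiset.map_map]
  congr 1
  refine Multiset.map_congr rfl fun s _ => ?_
  simp only [Function.comp, bump]
  split_ifs <;> omega

theorem gap_map_bump (hu : D < u) (hi : i ≠ 0) :
    gap D (M.map (bump u)) i = gap D M i + if numGE M u = i then 1 else 0 := by
  unfold gap
  simp only [numGE_map_bump]
  -- `φ` is the shift of columns that leaves position `u + 1` free for the duplicate.
  set φ : ℕ → ℕ := fun t => if t ≤ u then t else t + 1 with hφ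
  have hinj : Function.Injective φ := by
    intro a b hab
    simp only [hφ] at hab
    split_ifs at hab <;> omega
  rw [← Set.ncard_image_of_injective {t | D < t ∧ numGE M t = i} hinj]
  have hnot : u + 1 ∉ φ '' {t | D < t ∧ numGE M t = i} := by
    rintro ⟨t, -, ht⟩
    simp only [hφ] at ht
    split_ifs at ht <;> omega
  have himg : φ '' {t | D < t ∧ numGE M t = i} =
      {t | D < t ∧ (if t ≤ u then numGE M t else numGE M (t - 1)) = i} \ {u + 1} := by
    ext t
    simp only [Set.mem_image, Set.mem_ofPred_eq, Set.mem_sdiff, Set.mem_singleton_iff]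
    constructor
    · rintro ⟨s, ⟨h1, h2⟩, rfl⟩
      simp only [hφ]
      by_cases hs : s ≤ u
      · simp only [if_pos hs]
        exact ⟨⟨h1, h2⟩, by omega⟩
      · simp only [if_neg hs, if_neg (show ¬ s + 1 ≤ u by omega)]
        exact ⟨⟨by omega, h2⟩, by omega⟩
    · rintro ⟨⟨h1, h2⟩, h3⟩
      by_cases ht : t ≤ u
      · rw [if_pos ht] at h2
        exact ⟨t, ⟨h1, h2⟩, by simp [hφ, ht]⟩
      · rw [if_neg ht] at h2
        refine ⟨t - 1, ⟨by omega, h2⟩, ?_⟩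
        simp only [hφ]
        rw [if_neg (by omega)]
        omega
  split_ifs with h
  · rw [← Set.ncard_insert_of_notMem hnot ((finite_gap hi).image _), himg,
      Set.insert_sdiff_singleton, Set.insert_eq_of_mem]
    refine ⟨by omega, ?_⟩
    rw [if_neg (by omega)]
    exact h
  · rw [himg, Set.sdiff_singleton_eq_self, add_zero]
    rintro ⟨-, h2⟩
    rw [if_neg (by omega)] at h2
    exact h h2

/-- The cells of the Young diagram beyond column `D` are counted by columns, grouped by height; the
other cells make up `low`. -/
theorem sum_eq_low_add (D k : ℕ) (M : Multiset ℕ) (h : ∀ t, D < t → numGE M t ≤ k) :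
    M.sum = low D M + ∑ i ∈ Finset.Icc 1 k, i * gap D M i := by
  have h1 : ∀ N, (∀ s ∈ M, s ≤ N) → M.sum = low D M + ∑ t ∈ Finset.Ioc D N, numGE M t := by
    intro N
    unfold low numGE
    clear h
    induction M using Multiset.induction with
    | empty => simp
    | cons s M ih =>
      intro hN
      have hs := hN s (Multiset.mem_cons_self _ _)
      rw [Multiset.sum_cons, ih fun t ht => hN t (Multiset.mem_cons_of_mem ht), Multiset.map_cons,
        Multiset.sum_cons]
      simp only [Multiset.countP_cons, Finset.sum_add_distrib]
      have : ∑ t ∈ Finset.Ioc D N, (if t ≤ s then 1 else 0) = s - D := by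
        rw [← Finset.card_filter]
        have : (Finset.Ioc D N).filter (· ≤ s) = Finset.Ioc D s := by
          ext t
          simp only [Finset.mem_filter, Finset.mem_Ioc]
          omega
        rw [this, Nat.card_Ioc]
      rw [this]
      omega
  rw [h1 M.sum fun s hs => Multiset.single_le_sum (fun _ _ => Nat.zero_le _) _ hs]
  congr 1
  rw [← Finset.sum_fiberwise_of_maps_to (t := Finset.range (k + 1)) (g := numGE M)
    (fun t ht => Finset.mem_range_succ_iff.2 (h t (Finset.mem_Ioc.1 ht).1))]
  rw [Finset.range_eq_Ico, ← Finset.sum_Ioo_add_eq_sum_Ico (by omega)]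
  rw [Finset.sum_eq_zero (s := (Finset.Ioc D M.sum).filter fun t => numGE M t = 0)
    (fun t ht => (Finset.mem_filter.1 ht).2), add_zero]
  refine Finset.sum_congr ?_ fun i hi => ?_
  · ext i
    simp only [Finset.mem_Ioo, Finset.mem_Icc]
    omega
  · rw [Finset.sum_congr rfl fun t ht => (Finset.mem_filter.1 ht).2, Finset.sum_const, smul_eq_mul,
      mul_comm, gap, ← Set.ncard_coe_finset]
    congr 2
    ext t
    simp only [Finset.coe_filter, Finset.mem_Ioc, Set.mem_ofPred_eq]
    refine ⟨fun h => ⟨h.1.1, h.2⟩, fun h => ⟨⟨h.1, ?_⟩, h.2⟩⟩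
    by_contra hcon
    have := numGE_eq_zero (not_le.1 hcon)
    have := (Finset.mem_Icc.1 hi).1
    omega

/-- Column heights are antitone, so columns of equal height are consecutive. -/
theorem exists_numGE_succ_eq (h : 2 ≤ gap D M i) :
    ∃ t, D < t ∧ numGE M t = i ∧ numGE M (t + 1) = i := by
  obtain ⟨a, ha, b, hb, hab⟩ := (Set.one_lt_ncard
    (Set.finite_of_ncard_ne_zero (show gap D M i ≠ 0 by omega))).1 (show 1 < _ from h)
  wlog hlt : a < b generalizing a b
  · exact this b hb a ha hab.symm (by omega)
  refine ⟨a, ha.1, ha.2, le_antisymm ?_ ?_⟩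
  · exact ha.2 ▸ numGE_anti M (Nat.le_succ a)
  · exact hb.2 ▸ numGE_anti M hlt

theorem notMem_of_numGE_succ_eq {t : ℕ} (h : numGE M t = numGE M (t + 1)) : t ∉ M := fun ht => by
  have := (le_iff_le_of_numGE_eq h t ht).1 le_rfl
  omega

end Gaps

/-! ### A generating series with prescribed denominators -/

section Series

open PowerSeries

/-- This gives bijections between quotients from a relation on representatives, with
well-definedness and injectivity together in `h3`. -/
theorem card_eq_of_relation {A B : Type*} (r : A → B → Prop) (h1 : ∀ a, ∃ b, r a b)
    (h2 : ∀ b, ∃ a, r a b) (h3 : ∀ a a' b b', r a b → r a' b' → (a = a' ↔ b = b')) :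
    Nat.card A = Nat.card B := by
  choose f hf using h1
  refine Nat.card_congr (Equiv.ofBijective f ⟨fun a a' h => ?_, fun b => ?_⟩)
  · exact (h3 _ _ _ _ (hf a) (hf a')).2 h
  · obtain ⟨a, ha⟩ := h2 b
    exact ⟨a, (h3 _ _ _ _ (hf a) ha).1 rfl⟩

/-- The series `Z^i / (1 - Z^i)` if `b` holds, and `1` otherwise. -/
noncomputable def gapSeries (b : Prop) (i : ℕ) : PowerSeries ℤ :=
  PowerSeries.mk fun l => if (l ≠ 0 ↔ b) ∧ i ∣ l then 1 else 0

/-- The numerator of `gapSeries`. -/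
noncomputable def gapNumerator (b : Prop) (i : ℕ) : Polynomial ℤ :=
  if b then Polynomial.X ^ i else 1 - Polynomial.X ^ i

theorem gapSeries_mul (b : Prop) {i : ℕ} (hi : i ≠ 0) :
    gapSeries b i * (1 - X ^ i) = (gapNumerator b i : PowerSeries ℤ) := by
  unfold gapNumerator
  by_cases hb : b
  · rw [if_pos hb]
    ext n
    rw [mul_sub, mul_one, map_sub, coeff_mul_X_pow', Polynomial.coe_pow, Polynomial.coe_X,
      coeff_X_pow]
    simp only [gapSeries, coeff_mk, hb, iff_true]
    rcases lt_trichotomy n i with h | rfl | h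
    · have h1 : ¬ (n ≠ 0 ∧ i ∣ n) := fun h1 => by
        have := Nat.le_of_dvd (Nat.pos_of_ne_zero h1.1) h1.2
        omega
      rw [if_neg h1, if_neg (by omega), if_neg h.ne, sub_zero]
    · simp [hi]
    · have h1 : (n - i ≠ 0 ∧ i ∣ n - i) ↔ (n ≠ 0 ∧ i ∣ n) := by
        rw [← Nat.dvd_add_left (dvd_refl i), Nat.sub_add_cancel h.le]
        exact and_congr_left fun _ => by omega
      rw [if_pos h.le, if_neg h.ne', if_congr h1 rfl rfl, sub_self]
  · rw [if_neg hb]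
    have : gapSeries b i = 1 := by
      ext n
      simp only [gapSeries, coeff_mk, hb, iff_false, not_not, coeff_one]
      congr 1
      simp only [eq_iff_iff]
      exact ⟨fun h => h.1, fun h => ⟨h, h ▸ dvd_zero _⟩⟩
    rw [this]
    simp

/-- A family of objects with a bounded invariant `lo` and multiplicities `gp i`, the number of
objects with given invariants depending only on the set of the `i` for which `gp i` is positive,
has a generating series with denominator `(1 - Z) ⋯ (1 - Z^k)`. -/
theorem exists_polynomial_of_gaps {T : Type*} (k R : ℕ) (lo : T → ℕ) (gp : T → ℕ → ℕ)
    (hfin : ∀ n, {t | lo t + ∑ i ∈ Finset.Icc 1 k, i * gp t i = n}.Finite)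
    (hR : ∀ t, lo t ≤ R)
    (hcard : ∀ r (c : ℕ → ℕ), Nat.card {t // lo t = r ∧ ∀ i ∈ Finset.Icc 1 k, gp t i = c i} =
      Nat.card {t // lo t = r ∧ ∀ i ∈ Finset.Icc 1 k, gp t i = min (c i) 1})
    (hfull : ∃ t, ∀ i ∈ Finset.Icc 1 k, 1 ≤ gp t i) :
    ∃ P : Polynomial ℤ, P.eval 1 ≠ 0 ∧
      (PowerSeries.mk fun n =>
        (Nat.card {t // lo t + ∑ i ∈ Finset.Icc 1 k, i * gp t i = n} : ℤ)) *
        ∏ i ∈ Finset.Icc 1 k, (1 - X ^ i) = (P : PowerSeries ℤ) := by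
  -- The objects whose positive gaps are exactly those in `I`, each equal to `1`, stand for all gap
  -- vectors with support `I`.
  let g : ℕ → Finset ℕ → ℕ := fun r I =>
    Nat.card {t // lo t = r ∧ ∀ i ∈ Finset.Icc 1 k, gp t i = if i ∈ I then 1 else 0}
  have hg0 : ∀ r I, R < r → g r I = 0 := by
    intro r I hr
    have : IsEmpty {t // lo t = r ∧ ∀ i ∈ Finset.Icc 1 k, gp t i = if i ∈ I then 1 else 0} :=
      ⟨fun t => absurd (hR t.1) (by rw [t.2.1]; omega)⟩
    exact Nat.card_of_isEmpty
  let G : Finset ℕ → Polynomial ℤ := fun I =>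
    ∑ r ∈ Finset.range (R + 1), Polynomial.monomial r (g r I : ℤ)
  have hG : ∀ I, (G I : PowerSeries ℤ) = PowerSeries.mk fun r => (g r I : ℤ) := by
    intro I
    ext r
    rw [Polynomial.coeff_coe, coeff_mk, Polynomial.finsetSum_coeff]
    simp only [Polynomial.coeff_monomial]
    rw [Finset.sum_ite_eq' (Finset.range (R + 1)) r fun r => (g r I : ℤ)]
    split_ifs with h
    · rfl
    · rw [hg0 r I (by simpa using h)]; rfl
  have hH : (PowerSeries.mk fun n =>
        (Nat.card {t // lo t + ∑ i ∈ Finset.Icc 1 k, i * gp t i = n} : ℤ)) =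
      ∑ I ∈ (Finset.Icc 1 k).powerset, (G I : PowerSeries ℤ) *
        ∏ i ∈ Finset.Icc 1 k, gapSeries (i ∈ I) i := by
    ext n
    rw [coeff_mk, map_sum]
    have hcoeff : ∀ (I : Finset ℕ) m, coeff m (∏ i ∈ Finset.Icc 1 k, gapSeries (i ∈ I) i) =
        ∑ l ∈ Finset.finsuppAntidiag (Finset.Icc 1 k) m,
          if ∀ i ∈ Finset.Icc 1 k, (l i ≠ 0 ↔ i ∈ I) ∧ i ∣ l i then (1 : ℤ) else 0 := by
      intro I m
      rw [coeff_prod]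
      refine Finset.sum_congr rfl fun l _ => ?_
      simp only [gapSeries, coeff_mk]
      split_ifs with h
      · exact Finset.prod_eq_one fun i hi => if_pos (h i hi)
      · push Not at h
        obtain ⟨i, hi, hi'⟩ := h
        exact Finset.prod_eq_zero hi (if_neg fun h => hi' h.1 h.2)
    simp only [coeff_mul, hG, coeff_mk, hcoeff]
    rw [Finset.sum_comm]
    have hinner : ∀ p ∈ Finset.HasAntidiagonal.antidiagonal n, (∑ I ∈ (Finset.Icc 1 k).powerset, (g p.1 I : ℤ) *
        ∑ l ∈ Finset.finsuppAntidiag (Finset.Icc 1 k) p.2,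
          if ∀ i ∈ Finset.Icc 1 k, (l i ≠ 0 ↔ i ∈ I) ∧ i ∣ l i then (1 : ℤ) else 0) =
        ∑ l ∈ Finset.finsuppAntidiag (Finset.Icc 1 k) p.2,
          ((Nat.card {t // lo t = p.1 ∧ ∀ i ∈ Finset.Icc 1 k, i * gp t i = l i} : ℕ) : ℤ) := by
      intro p _
      simp only [Finset.mul_sum]
      rw [Finset.sum_comm]
      refine Finset.sum_congr rfl fun l hl => ?_
      simp only [mul_ite, mul_one, mul_zero]
      by_cases hdvd : ∀ i ∈ Finset.Icc 1 k, i ∣ l i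
      -- Only `I` equal to the support of `l` contributes; here `l i` stands for `i * gp t i`.
      · rw [Finset.sum_eq_single ((Finset.Icc 1 k).filter fun i => l i ≠ 0)]
        · rw [if_pos fun i hi => ⟨by simp only [Finset.mem_filter, hi, true_and], hdvd i hi⟩]
          have e1 := hcard p.1 fun i => l i / i
          have e2 : ∀ t, (∀ i ∈ Finset.Icc 1 k, i * gp t i = l i) ↔
              ∀ i ∈ Finset.Icc 1 k, gp t i = l i / i := fun t => by
            refine forall₂_congr fun i hi => ?_
            have hi' := (Finset.mem_Icc.1 hi).1
            obtain ⟨m, hm⟩ := hdvd i hi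
            rw [hm, Nat.mul_div_cancel_left _ (by omega)]
            exact Nat.mul_right_inj (by omega)
          have e3 : ∀ t, (∀ i ∈ Finset.Icc 1 k, gp t i = min (l i / i) 1) ↔
              ∀ i ∈ Finset.Icc 1 k,
                gp t i = if i ∈ (Finset.Icc 1 k).filter fun i => l i ≠ 0 then 1 else 0 := fun t => by
            refine forall₂_congr fun i hi => ?_
            have hi' := (Finset.mem_Icc.1 hi).1
            obtain ⟨m, hm⟩ := hdvd i hi
            simp only [Finset.mem_filter, hi, true_and]
            rw [hm, Nat.mul_div_cancel_left _ (by omega)]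
            have : i * m ≠ 0 ↔ m ≠ 0 := by
              rw [Ne, mul_eq_zero, not_or]
              exact ⟨fun h => h.2, fun h => ⟨by omega, h⟩⟩
            rw [if_congr this rfl rfl]
            split_ifs with h
            · rw [min_eq_right (by omega)]
            · rw [min_eq_left (by omega)]; simp only [not_not] at h; rw [h]
          simp only [g, e2, e1, e3]
        · intro I hI hne
          refine if_neg fun h => hne ?_
          ext i
          simp only [Finset.mem_filter]
          constructor
          · intro hi
            have := Finset.mem_powerset.1 hI hi
            exact ⟨this, (h i this).1.2 hi⟩
          · rintro ⟨hi, hli⟩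
            exact (h i hi).1.1 hli
        · intro h
          exact absurd (Finset.mem_powerset.2 (Finset.filter_subset _ _)) h
      · rw [Finset.sum_eq_zero fun I _ => if_neg fun h => hdvd fun i hi => (h i hi).2]
        have : IsEmpty {t // lo t = p.1 ∧ ∀ i ∈ Finset.Icc 1 k, i * gp t i = l i} :=
          ⟨fun t => hdvd fun i hi => ⟨_, (t.2.2 i hi).symm⟩⟩
        rw [Nat.card_of_isEmpty]; rfl
    rw [Finset.sum_congr rfl hinner, Finset.sum_sigma', ← Nat.cast_sum, Nat.cast_inj]
    let ι := (Finset.HasAntidiagonal.antidiagonal n).sigma fun p => Finset.finsuppAntidiag (Finset.Icc 1 k) p.2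
    set F := (hfin n).toFinset with hF
    have hcF : Nat.card {t // lo t + ∑ i ∈ Finset.Icc 1 k, i * gp t i = n} = F.card := by
      rw [← Nat.card_eq_finsetCard]
      exact Nat.card_congr (Equiv.subtypeEquivRight fun t => (hfin n).mem_toFinset.symm)
    -- Objects of total `n` are sorted by `lo` and by the values `i * gp t i`; outside `Icc 1 k` the
    -- function is set to zero so that it is finitely supported.
    let key : T → Σ _ : ℕ × ℕ, ℕ →₀ ℕ := fun t =>
      ⟨(lo t, ∑ i ∈ Finset.Icc 1 k, i * gp t i),
        Finsupp.onFinset (Finset.Icc 1 k) (fun i => if i ∈ Finset.Icc 1 k then i * gp t i else 0)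
          fun i hi => by by_contra hcon; rw [if_neg hcon] at hi; exact hi rfl⟩
    have hkey : ∀ t ∈ F, key t ∈ ι := by
      intro t ht
      have ht : lo t + ∑ i ∈ Finset.Icc 1 k, i * gp t i = n := (hfin n).mem_toFinset.1 ht
      refine Finset.mem_sigma.2 ⟨Finset.HasAntidiagonal.mem_antidiagonal.2 ht, ?_⟩
      rw [Finset.mem_finsuppAntidiag]
      refine ⟨?_, fun i hi => by
        by_contra hcon
        exact Finsupp.mem_support_iff.1 hi (if_neg hcon)⟩
      exact Finset.sum_congr rfl fun i hi => by simp only [key, Finsupp.onFinset_apply, if_pos hi]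
    rw [hcF, Finset.card_eq_sum_card_fiberwise hkey]
    refine Finset.sum_congr rfl fun x hx => ?_
    obtain ⟨⟨r, m⟩, l⟩ := x
    obtain ⟨hx1, hx2⟩ := Finset.mem_sigma.1 hx
    rw [Finset.HasAntidiagonal.mem_antidiagonal] at hx1
    rw [Finset.mem_finsuppAntidiag] at hx2
    simp only at hx1 hx2
    rw [← Nat.card_eq_finsetCard]
    refine Nat.card_congr (Equiv.subtypeEquivRight fun t => ?_)
    rw [Finset.mem_filter, hF, (hfin n).mem_toFinset]
    simp only [Set.mem_ofPred_eq, key]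
    constructor
    · rintro ⟨-, h⟩
      simp only [Sigma.mk.injEq, Prod.mk.injEq, heq_eq_eq] at h
      refine ⟨h.1.1, fun i hi => ?_⟩
      rw [← h.2, Finsupp.onFinset_apply, if_pos hi]
    · rintro ⟨h1, h2⟩
      have h3 : ∑ i ∈ Finset.Icc 1 k, i * gp t i = m := by
        rw [Finset.sum_congr rfl h2]; exact hx2.1
      refine ⟨by rw [h1, h3, hx1], ?_⟩
      simp only [Sigma.mk.injEq, Prod.mk.injEq, heq_eq_eq]
      refine ⟨⟨h1, h3⟩, ?_⟩
      ext i
      rw [Finsupp.onFinset_apply]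
      split_ifs with hi
      · exact h2 i hi
      · by_contra hcon
        exact hi (hx2.2 (Finsupp.mem_support_iff.2 (Ne.symm hcon)))
  refine ⟨∑ I ∈ (Finset.Icc 1 k).powerset, G I * ∏ i ∈ Finset.Icc 1 k, gapNumerator (i ∈ I) i,
    ?_, ?_⟩
  -- At `Z = 1` a factor `1 - Z^i` kills every term except that of the full set `I`, whose value
  -- counts objects.
  · rw [Polynomial.eval_finsetSum, Finset.sum_eq_single (Finset.Icc 1 k)]
    · rw [Polynomial.eval_mul, Polynomial.eval_prod,
        Finset.prod_eq_one fun i hi => by simp [gapNumerator, hi], mul_one,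
        Polynomial.eval_finsetSum]
      simp only [Polynomial.eval_monomial, one_pow, mul_one]
      rw [← Nat.cast_sum, Nat.cast_ne_zero]
      obtain ⟨t, ht⟩ := hfull
      have h1 : 0 < g (lo t) (Finset.Icc 1 k) := by
        have e := hcard (lo t) (gp t)
        have e2 : ∀ s, (∀ i ∈ Finset.Icc 1 k, gp s i = min (gp t i) 1) ↔
            ∀ i ∈ Finset.Icc 1 k, gp s i = if i ∈ Finset.Icc 1 k then 1 else 0 := fun s =>
          forall₂_congr fun i hi => by rw [if_pos hi, min_eq_right (ht i hi)]
        simp only [e2] at e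
        simp only [g]
        rw [← e]
        have : Finite {s // lo s = lo t ∧ ∀ i ∈ Finset.Icc 1 k, gp s i = gp t i} := by
          refine Set.Finite.subset (hfin (lo t + ∑ i ∈ Finset.Icc 1 k, i * gp t i)) ?_
          rintro s ⟨hs1, hs2⟩
          simp only [Set.mem_ofPred_eq]
          rw [hs1, Finset.sum_congr rfl fun i hi => by rw [hs2 i hi] ]
        have : Nonempty {s // lo s = lo t ∧ ∀ i ∈ Finset.Icc 1 k, gp s i = gp t i} :=
          ⟨t, rfl, fun _ _ => rfl⟩
        exact Nat.card_pos
      have h2 := Finset.single_le_sum (f := fun r => g r (Finset.Icc 1 k))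
        (fun _ _ => Nat.zero_le _) (Finset.mem_range_succ_iff.2 (hR t))
      exact (h1.trans_le h2).ne'
    · intro I hI hne
      obtain ⟨i, hi, hiI⟩ : ∃ i ∈ Finset.Icc 1 k, i ∉ I := by
        by_contra hcon
        push Not at hcon
        exact hne (Finset.Subset.antisymm (Finset.mem_powerset.1 hI) hcon)
      rw [Polynomial.eval_mul, Polynomial.eval_prod, Finset.prod_eq_zero hi, mul_zero]
      simp [gapNumerator, hiI]
    · intro h
      exact absurd (Finset.mem_powerset_self _) h
  · rw [hH, Finset.sum_mul, ← Polynomial.coeToPowerSeries.ringHom_apply, map_sum]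
    refine Finset.sum_congr rfl fun I _ => ?_
    rw [mul_assoc, ← Finset.prod_mul_distrib, map_mul, map_prod,
      Polynomial.coeToPowerSeries.ringHom_apply]
    congr 1
    refine Finset.prod_congr rfl fun i hi => ?_
    rw [gapSeries_mul _ (by have := (Finset.mem_Icc.1 hi).1; omega)]
    rfl

end Series

end MonoDec

namespace MonoDec

open FirstOrder Classical

/-! ### Isomorphism types of all finite restrictions -/

section Types

variable (L : FirstOrder.Language.{u, v}) [L.IsRelational] (E : Type w) [L.Structure E]

/-- The relation `SameType` on all finite subsets. -/
def sameTypeSetoid : Setoid (Finset E) where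
  r := SameType L
  iseqv := ⟨SameType.refl L, SameType.symm, SameType.trans⟩

/-- The isomorphism types of the finite restrictions. -/
abbrev Types : Type w := Quotient (sameTypeSetoid L E)

variable {L E}

/-- The sizes of the exchangeability classes of an isomorphism type. -/
noncomputable def Types.sizes : Types L E → Multiset ℕ :=
  Quotient.lift (MonoDec.sizes L) fun _ _ h => SameType.sizes_eq h

/-- The isomorphism type of a finite subset. -/
def Types.of (S : Finset E) : Types L E := Quotient.mk (sameTypeSetoid L E) S

theorem Types.sizes_of (S : Finset E) : (Types.of S : Types L E).sizes = MonoDec.sizes L S := rfl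

theorem Types.of_eq_of {S T : Finset E} : (Types.of S : Types L E) = Types.of T ↔ SameType L S T :=
  Quotient.eq (r := sameTypeSetoid L E)

theorem Types.exists_of (τ : Types L E) : ∃ S, Types.of S = τ := Quotient.exists_rep τ

theorem profile_eq (n : ℕ) :
    profile L E n = Nat.card {τ : Types L E // τ.sizes.sum = n} := by
  refine card_eq_of_relation (fun a b => ∃ A : {A : Finset E // A.card = n},
    a = Quotient.mk (typeSetoid L E n) A ∧ b.1 = Types.of A.1) ?_ ?_ ?_
  · intro a
    obtain ⟨A, rfl⟩ := Quotient.exists_rep a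
    exact ⟨⟨Types.of A.1, (sum_sizes A.1).trans A.2⟩, A, rfl, rfl⟩
  · rintro ⟨b, hb⟩
    obtain ⟨A, rfl⟩ := b.exists_of
    exact ⟨_, ⟨A, (sum_sizes A).symm.trans hb⟩, rfl, rfl⟩
  · rintro _ _ ⟨b, hb⟩ ⟨b', hb'⟩ ⟨A, rfl, h1⟩ ⟨B, rfl, h2⟩
    simp only at h1 h2
    subst h1 h2
    rw [Subtype.mk.injEq, Types.of_eq_of]
    exact Quotient.eq (r := typeSetoid L E n)

variable {X : Type*} {cls : E → X} {d D : ℕ}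

theorem finite_types [Fintype X]
    (hcls : ∀ A B : Finset E, (∀ x, cnt cls A x = cnt cls B x) → SameType L A B) (n : ℕ) :
    {τ : Types L E | τ.sizes.sum = n}.Finite := by
  have hout : ∀ τ : Types L E, Types.of τ.out = τ := fun τ => Quotient.out_eq τ
  refine Set.Finite.of_injOn (f := fun τ : Types L E => cnt cls τ.out)
    (t := Set.Iic fun _ => n) ?_ ?_ (Set.finite_Iic _)
  · intro τ hτ x
    have h1 : τ.sizes.sum = n := hτ
    rw [← hout τ, Types.sizes_of, sum_sizes] at h1
    exact (Finset.card_filter_le _ _).trans h1.le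
  · intro τ _ τ' _ h
    rw [← hout τ, ← hout τ', Types.of_eq_of]
    exact hcls _ _ fun x => congrFun h x

theorem finite_isoTypes [Fintype X]
    (hcls : ∀ A B : Finset E, (∀ x, cnt cls A x = cnt cls B x) → SameType L A B) (n : ℕ) :
    Finite (IsoTypes L E n) := by
  refine Finite.of_injective (β := X → Fin (n + 1)) (fun τ x => ⟨cnt cls τ.out.1 x, ?_⟩) ?_
  · exact Nat.lt_succ_of_le ((Finset.card_filter_le _ _).trans τ.out.2.le)
  · intro τ τ' h
    rw [← Quotient.out_eq τ, ← Quotient.out_eq τ']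
    refine Quotient.sound (hcls _ _ fun x => ?_)
    exact congrArg Fin.val (congrFun h x)

/-- An exchangeability class is determined by the block of any of its points, so the left side, as a
function of `cls a`, covers all classes of `S`. -/
theorem block_eq_filter
    (hcls : ∀ A B : Finset E, (∀ x, cnt cls A x = cnt cls B x) → SameType L A B)
    {S : Finset E} {a : E} (ha : a ∈ S) :
    S.filter (fun b => ∃ a' ∈ S, cls a' = cls a ∧ ExchIn L S a' b) = block L S a := by
  refine Finset.filter_congr fun b hb => ⟨?_, fun h => ⟨a, ha, rfl, h⟩⟩
  rintro ⟨a', ha', h1, h2⟩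
  exact (exchIn_of_cls_eq hcls h1.symm S).trans h2 ha hb

variable [Fintype X]

theorem low_sizes_le
    (hcls : ∀ A B : Finset E, (∀ x, cnt cls A x = cnt cls B x) → SameType L A B)
    (S : Finset E) : low D (sizes L S) ≤ Fintype.card X * D := by
  have h1 : (blocks L S).card ≤ Fintype.card X := by
    refine Finset.card_le_card_of_surjOn
      (fun x => S.filter fun b => ∃ a ∈ S, cls a = x ∧ ExchIn L S a b) (s := Finset.univ) ?_
    intro C hC
    obtain ⟨a, ha, rfl⟩ := mem_blocks.1 (Finset.mem_coe.1 hC)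
    exact ⟨cls a, by simp, block_eq_filter hcls ha⟩
  unfold low sizes
  rw [Multiset.map_map]
  refine (Finset.sum_le_card_nsmul (blocks L S) (fun C => min C.card D) D
    fun C _ => min_le_right _ _).trans ?_
  exact Nat.mul_le_mul_right _ h1

theorem numGE_sizes (S : Finset E) (t : ℕ) :
    numGE (sizes L S) t = ((blocks L S).filter fun C => t ≤ C.card).card := by
  unfold numGE sizes
  rw [Multiset.countP_map]
  rfl

/-- Every class of size at least `t` contains more than `d` points of one block, which is therefore
infinite and determines the class. -/
theorem numGE_sizes_le (hd : IsLevel L cls d) {t : ℕ} (ht : Fintype.card X * d < t)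
    (S : Finset E) : numGE (sizes L S) t ≤ {x | (cls ⁻¹' {x}).Infinite}.ncard := by
  have hI : {x | (cls ⁻¹' {x}).Infinite}.ncard =
      (Finset.univ.filter fun x => (cls ⁻¹' {x}).Infinite).card := by
    rw [← Set.ncard_coe_finset]
    congr 1
    ext x
    simp
  rw [numGE_sizes, hI]
  refine Finset.card_le_card_of_surjOn
    (fun x => S.filter fun b => ∃ a ∈ S, cls a = x ∧ ExchIn L S a b) ?_
  intro C hC
  obtain ⟨hC1, hC2⟩ := Finset.mem_filter.1 (Finset.mem_coe.1 hC)
  obtain ⟨z, hz, hzd⟩ := exists_large_class (cls := cls) ht hC2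
  obtain ⟨hzS, rfl⟩ := block_eq_of_mem hC1 hz
  refine ⟨cls z, ?_, block_eq_filter hd.hcls hzS⟩
  rw [Finset.mem_coe, Finset.mem_filter]
  exact ⟨Finset.mem_univ _, hd.inf _ _ hzd.le⟩

-- Duplicating a column of height `i`, one of which exists because `c i ≠ 0`, is a bijection on
-- types. Which of the equal columns is duplicated does not matter.
variable (D) in
theorem card_types_update (hd : IsLevel L cls d) (h1 : Fintype.card (X × X) * d ≤ D)
    (h2 : Fintype.card X * d ≤ D) {k r i : ℕ} (c : ℕ → ℕ) (hi : i ∈ Finset.Icc 1 k)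
    (hc : c i ≠ 0) :
    Nat.card {τ : Types L E // low D τ.sizes = r ∧ ∀ j ∈ Finset.Icc 1 k, gap D τ.sizes j = c j} =
      Nat.card {τ : Types L E // low D τ.sizes = r ∧ ∀ j ∈ Finset.Icc 1 k,
        gap D τ.sizes j = Function.update c i (c i + 1) j} := by
  have hi0 : i ≠ 0 := by have := (Finset.mem_Icc.1 hi).1; omega
  have hlow : ∀ {S S' : Finset E} {u}, D < u → Up L cls d u S S' →
      low D (sizes L S') = low D (sizes L S) := fun hu h => by
    rw [h.sizes_eq hd, low_map_bump hu.le]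
  have hgap : ∀ {S S' : Finset E} {u}, D < u → numGE (sizes L S) u = i → Up L cls d u S S' →
      ∀ j ∈ Finset.Icc 1 k, gap D (sizes L S') j = gap D (sizes L S) j + if i = j then 1 else 0 :=
    fun hu hn h j hj => by
      rw [h.sizes_eq hd, gap_map_bump hu (by have := (Finset.mem_Icc.1 hj).1; omega), hn]
  have hnum : ∀ {S S' : Finset E} {u}, Up L cls d u S S' → ∀ t, numGE (sizes L S') t =
      if t ≤ u then numGE (sizes L S) t else numGE (sizes L S) (t - 1) := fun h t => by
    rw [h.sizes_eq hd, numGE_map_bump]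
  have hupd : ∀ j, Function.update c i (c i + 1) j = c j + if i = j then 1 else 0 := by
    intro j
    by_cases hij : i = j
    · subst hij; simp
    · rw [Function.update_of_ne (Ne.symm hij), if_neg hij, add_zero]
  refine card_eq_of_relation (fun a b => ∃ S S' u, a.1 = Types.of S ∧ b.1 = Types.of S' ∧ D < u ∧
    numGE (sizes L S) u = i ∧ Up L cls d u S S') ?_ ?_ ?_
  · rintro ⟨τ, hτ1, hτ2⟩
    obtain ⟨S, rfl⟩ := τ.exists_of
    rw [Types.sizes_of] at hτ1 hτ2
    obtain ⟨u, hu, hui⟩ := Set.nonempty_of_ncard_ne_zero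
      (show gap D (sizes L S) i ≠ 0 by rw [hτ2 i hi]; exact hc)
    obtain ⟨S', hS'⟩ := exists_up hd (h1.trans hu.le) S
    refine ⟨⟨Types.of S', ?_, ?_⟩, S, S', u, rfl, rfl, hu, hui, hS'⟩
    · rw [Types.sizes_of, hlow hu hS', hτ1]
    · intro j hj
      rw [Types.sizes_of, hgap hu hui hS' j hj, hτ2 j hj, hupd]
  · rintro ⟨τ, hτ1, hτ2⟩
    obtain ⟨S', rfl⟩ := τ.exists_of
    rw [Types.sizes_of] at hτ1 hτ2
    -- Two columns of height `i` give two adjacent ones, so no class has size `u` and the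
    -- enlargement can be undone.
    obtain ⟨u, hu, hui, hui'⟩ := exists_numGE_succ_eq
      (show 2 ≤ gap D (sizes L S') i by rw [hτ2 i hi, hupd, if_pos rfl]; omega)
    obtain ⟨S, hS⟩ := exists_down hd (by omega : Fintype.card X * d < u + 1)
      (notMem_of_numGE_succ_eq (hui.trans hui'.symm))
    have hn : numGE (sizes L S) u = i := by
      rw [← hui, hnum hS, if_pos le_rfl]
    refine ⟨⟨Types.of S, ?_, ?_⟩, S, S', u, rfl, rfl, hu, hn, hS⟩
    · rw [Types.sizes_of, ← hlow hu hS, hτ1]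
    · intro j hj
      have := hgap hu hn hS j hj
      rw [hτ2 j hj, hupd] at this
      rw [Types.sizes_of]
      omega
  · rintro ⟨a, ha⟩ ⟨a', ha'⟩ ⟨b, hb⟩ ⟨b', hb'⟩ ⟨S, S', u, e1, e2, hu, hn, h⟩
      ⟨T, T', u', e1', e2', hu', hn', h'⟩
    simp only at e1 e2 e1' e2'
    subst e1 e2 e1' e2'
    rw [Subtype.mk.injEq, Subtype.mk.injEq, Types.of_eq_of, Types.of_eq_of]
    constructor
    · intro hST
      have h3 : Up L cls d u T T' :=
        h'.congr_level (le_iff_le_of_numGE_eq (by rw [hn', ← hST.sizes_eq, hn]))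
      exact hST.up hd (h1.trans hu.le) h h3
    · intro hST
      have h3 : Up L cls d u T T' := by
        refine h'.congr_level (le_iff_le_of_numGE_eq ?_)
        rw [hn']
        -- In `S'` the columns `u` and `u + 1` both have height `i`. Depending on the position of
        -- `u'`, one of them is column `u` of `T` in the diagram of `T'`.
        rcases le_or_gt u u' with huu | huu
        · have := hnum h' u
          rw [if_pos huu, ← hST.sizes_eq, hnum h, if_pos le_rfl, hn] at this
          exact this
        · have := hnum h' (u + 1)
          rw [if_neg (by omega), ← hST.sizes_eq, hnum h, if_neg (by omega)] at this
          simp only [Nat.add_sub_cancel] at this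
          rw [hn] at this
          exact this
      exact hST.down hd h h3

theorem card_types_min (hd : IsLevel L cls d) (h1 : Fintype.card (X × X) * d ≤ D)
    (h2 : Fintype.card X * d ≤ D) (k r : ℕ) (c : ℕ → ℕ) :
    Nat.card {τ : Types L E // low D τ.sizes = r ∧ ∀ j ∈ Finset.Icc 1 k, gap D τ.sizes j = c j} =
      Nat.card {τ : Types L E // low D τ.sizes = r ∧ ∀ j ∈ Finset.Icc 1 k,
        gap D τ.sizes j = min (c j) 1} := by
  induction hm : ∑ i ∈ Finset.Icc 1 k, c i using Nat.strong_induction_on generalizing c with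
  | _ m ih =>
    by_cases hle : ∀ i ∈ Finset.Icc 1 k, c i ≤ 1
    · have : ∀ τ : Types L E, (∀ j ∈ Finset.Icc 1 k, gap D τ.sizes j = c j) ↔
          ∀ j ∈ Finset.Icc 1 k, gap D τ.sizes j = min (c j) 1 := fun τ =>
        forall₂_congr fun i hi => by rw [min_eq_left (hle i hi)]
      simp only [this]
    · push Not at hle
      obtain ⟨i, hi, hci⟩ := hle
      have hlt : ∑ j ∈ Finset.Icc 1 k, Function.update c i (c i - 1) j < m := by
        rw [← hm]
        refine Finset.sum_lt_sum (fun j _ => ?_) ⟨i, hi, by simp; omega⟩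
        by_cases hij : j = i
        · subst hij; simp
        · rw [Function.update_of_ne hij]
      -- An entry `c i ≥ 2` is lowered by one; it stays nonzero, as `card_types_update` requires.
      have e1 := ih _ hlt (Function.update c i (c i - 1)) rfl
      have e2 := card_types_update (L := L) (r := r) D hd h1 h2 (Function.update c i (c i - 1)) hi
        (by simp; omega)
      rw [Function.update_idem, Function.update_self, Nat.sub_add_cancel (by omega),
        Function.update_eq_self] at e2
      rw [← e2, e1]
      have : ∀ j, min (Function.update c i (c i - 1) j) 1 = min (c j) 1 := by
        intro j
        by_cases hij : j = i
        · subst hij; simp; omega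
        · rw [Function.update_of_ne hij]
      simp only [this]

theorem exists_superset_cnt_eq (S : Finset E) (n : X → ℕ) (hn : ∀ x, cnt cls S x ≤ n x) :
    ∃ T, S ⊆ T ∧ (∀ x, (cls ⁻¹' {x}).Infinite → cnt cls T x = n x) ∧
      ∀ x, ¬ (cls ⁻¹' {x}).Infinite → cnt cls T x = cnt cls S x := by
  have h : ∀ x, ∃ F : Finset E, S.filter (fun a => cls a = x) ⊆ F ∧ (∀ a ∈ F, cls a = x) ∧
      ((cls ⁻¹' {x}).Infinite → F.card = n x) ∧
      (¬ (cls ⁻¹' {x}).Infinite → F.card = cnt cls S x) := by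
    intro x
    by_cases hx : (cls ⁻¹' {x}).Infinite
    · obtain ⟨F, hF, hc⟩ := (hx.sdiff S.finite_toSet).exists_subset_card_eq (n x - cnt cls S x)
      refine ⟨S.filter (fun a => cls a = x) ∪ F, Finset.subset_union_left, fun a ha => ?_,
        fun _ => ?_, fun h => absurd hx h⟩
      · rcases Finset.mem_union.1 ha with ha | ha
        · exact (Finset.mem_filter.1 ha).2
        · exact (hF ha).1
      · rw [Finset.card_union_of_disjoint, card_filter_eq_cnt, hc]
        · have := hn x
          omega
        · rw [Finset.disjoint_left]
          exact fun a ha haF => (hF haF).2 (Finset.mem_filter.1 ha).1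
    · exact ⟨_, Finset.Subset.refl _, fun a ha => (Finset.mem_filter.1 ha).2,
        fun h => absurd h hx, fun _ => rfl⟩
  choose F hF1 hF2 hF3 hF4 using h
  have hc : ∀ x, cnt cls (Finset.univ.biUnion F) x = (F x).card := by
    intro x
    unfold cnt
    congr 1
    ext a
    simp only [Finset.mem_filter, Finset.mem_biUnion, Finset.mem_univ, true_and]
    constructor
    · rintro ⟨⟨y, hy⟩, rfl⟩
      rwa [← hF2 y a hy] at hy
    · intro ha
      exact ⟨⟨x, ha⟩, hF2 x a ha⟩
  refine ⟨Finset.univ.biUnion F, fun a ha => ?_, fun x hx => (hc x).trans (hF3 x hx),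
    fun x hx => (hc x).trans (hF4 x hx)⟩
  exact Finset.mem_biUnion.2 ⟨cls a, Finset.mem_univ _, hF1 _ (Finset.mem_filter.2 ⟨ha, rfl⟩)⟩

/-- Finitely many witnesses separate all pairs of blocks through chosen representatives; their
union, together with the representatives, separates arbitrary points, since points of a block are
exchangeable. -/
theorem exists_separating_finset
    (hcls : ∀ A B : Finset E, (∀ x, cnt cls A x = cnt cls B x) → SameType L A B)
    (hsurj : Function.Surjective cls)
    (hsep : ∀ a b, cls a ≠ cls b → ∃ S : Finset E, ¬ ExchIn L S a b) :
    ∃ S₀ : Finset E, ∀ S, S₀ ⊆ S → ∀ a ∈ S, ∀ b ∈ S, ExchIn L S a b ↔ cls a = cls b := by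
  choose rep hrep using hsurj
  have h : ∀ p : X × X, ∃ S : Finset E, p.1 ≠ p.2 → ¬ ExchIn L S (rep p.1) (rep p.2) := by
    intro p
    by_cases hp : p.1 = p.2
    · exact ⟨∅, fun h => absurd hp h⟩
    · obtain ⟨S, hS⟩ := hsep (rep p.1) (rep p.2) (by rwa [hrep, hrep])
      exact ⟨S, fun _ => hS⟩
  choose F hF using h
  refine ⟨Finset.univ.biUnion F ∪ Finset.univ.image rep, fun S hS a ha b hb =>
    ⟨fun hab => ?_, fun hab => exchIn_of_cls_eq hcls hab S⟩⟩
  by_contra hne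
  have hr : ∀ x, rep x ∈ S := fun x =>
    hS (Finset.mem_union_right _ (Finset.mem_image_of_mem _ (Finset.mem_univ x)))
  have hsub : F (cls a, cls b) ⊆ S :=
    (Finset.subset_biUnion_of_mem F (Finset.mem_univ _)).trans (Finset.subset_union_left.trans hS)
  refine hF (cls a, cls b) hne (ExchIn.mono ?_ hsub)
  exact ((exchIn_of_cls_eq hcls (hrep (cls a)) S).trans hab (hr _) hb).trans
    (exchIn_of_cls_eq hcls (hrep (cls b)).symm S) (hr _) (hr _)

theorem exists_gap_pos (hd : IsLevel L cls d) (hdD : d ≤ D) (hsurj : Function.Surjective cls)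
    (hsep : ∀ a b, cls a ≠ cls b → ∃ S : Finset E, ¬ ExchIn L S a b) {k : ℕ}
    (hk : k = {x | (cls ⁻¹' {x}).Infinite}.ncard) :
    ∃ S : Finset E, ∀ i ∈ Finset.Icc 1 k, 1 ≤ gap D (sizes L S) i := by
  obtain ⟨S₀, hS₀⟩ := exists_separating_finset hd.hcls hsurj hsep
  let e : {x | (cls ⁻¹' {x}).Infinite} ≃ Fin k := Finite.equivFinOfCardEq hk.symm
  -- The infinite blocks receive the counts `N, N + 1, …, N + k - 1`, large enough to contain `S₀`
  -- and to exceed `D`. As `S` contains `S₀`, its classes are the traces of the blocks, and column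
  -- `N + (k - i)` has height `i`.
  let N := D + 1 + S₀.card
  obtain ⟨S, hSS, h1, h2⟩ := exists_superset_cnt_eq (cls := cls) S₀
    (fun x => N + if h : (cls ⁻¹' {x}).Infinite then (e ⟨x, h⟩ : ℕ) else 0)
    (fun x => (Finset.card_filter_le _ _).trans (by omega))
  have hblock : ∀ a ∈ S, block L S a = S.filter fun b => cls b = cls a := fun a ha =>
    Finset.filter_congr fun b hb => by rw [hS₀ S hSS a ha b hb, eq_comm]
  have hnum : ∀ i, 1 ≤ i → i ≤ k → numGE (sizes L S) (N + (k - i)) = i := by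
    intro i hi hik
    have hfin : (Finset.univ.filter fun j : Fin k => k - i ≤ (j : ℕ)).card = i := by
      have : (Finset.univ.filter fun j : Fin k => k - i ≤ (j : ℕ)) =
          Finset.Ici (⟨k - i, by omega⟩ : Fin k) := by
        ext j
        simp [Fin.le_def]
      rw [this, Fin.card_Ici]
      simp only
      omega
    rw [numGE_sizes, ← hfin]
    symm
    refine Finset.card_bij (fun j _ => S.filter fun b => cls b = (e.symm j : X)) ?_ ?_ ?_
    · intro j hj
      have hj' := (Finset.mem_filter.1 hj).2
      have hc : cnt cls S (e.symm j : X) = N + j := by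
        rw [h1 _ (e.symm j).2, dif_pos (show (cls ⁻¹' {(e.symm j : X)}).Infinite from (e.symm j).2)]; simp
      obtain ⟨a, ha, haj⟩ := exists_mem_of_cnt_pos (cls := cls) (S := S) (x := e.symm j)
        (by omega)
      refine Finset.mem_filter.2 ⟨?_, ?_⟩
      · rw [← haj, ← hblock a ha]
        exact block_mem_blocks ha
      · rw [card_filter_eq_cnt, hc]; omega
    · intro j hj j' hj' heq
      have hc : 0 < cnt cls S (e.symm j : X) := by
        rw [h1 _ (e.symm j).2]; omega
      obtain ⟨a, ha, haj⟩ := exists_mem_of_cnt_pos hc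
      have : a ∈ S.filter fun b => cls b = (e.symm j' : X) := by
        rw [← heq]; exact Finset.mem_filter.2 ⟨ha, haj⟩
      exact e.symm.injective (Subtype.ext (haj.symm.trans (Finset.mem_filter.1 this).2))
    · intro C hC
      obtain ⟨hC, hCt⟩ := Finset.mem_filter.1 hC
      obtain ⟨a, ha, rfl⟩ := mem_blocks.1 hC
      rw [hblock a ha, card_filter_eq_cnt] at hCt
      have hinf : (cls ⁻¹' {cls a}).Infinite := hd.inf S _ (by omega)
      refine ⟨e ⟨cls a, hinf⟩, ?_, ?_⟩
      · rw [h1 _ hinf, dif_pos hinf] at hCt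
        simp only [Finset.mem_filter, Finset.mem_univ, true_and]
        omega
      · rw [Equiv.symm_apply_apply, hblock a ha]
  refine ⟨S, fun i hi => ?_⟩
  obtain ⟨hi1, hik⟩ := Finset.mem_Icc.1 hi
  rw [Nat.one_le_iff_ne_zero]
  refine (Set.ncard_pos (finite_gap (by omega))).2 ⟨N + (k - i), ?_, ?_⟩ |>.ne'
  · show D < D + 1 + S₀.card + (k - i)
    omega
  · exact hnum i hi1 hik

theorem exists_polynomial_generatingSeries [Nonempty X]
    (hcls : ∀ A B : Finset E, (∀ x, cnt cls A x = cnt cls B x) → SameType L A B)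
    (hsurj : Function.Surjective cls)
    (hsep : ∀ a b, cls a ≠ cls b → ∃ S : Finset E, ¬ ExchIn L S a b) {k : ℕ}
    (hk : k = {x | (cls ⁻¹' {x}).Infinite}.ncard) :
    ∃ P : Polynomial ℤ, P.eval 1 ≠ 0 ∧
      generatingSeries L E * ∏ i ∈ Finset.Icc 1 k, (1 - PowerSeries.X ^ i) =
        (P : PowerSeries ℤ) := by
  obtain ⟨d, hd⟩ := exists_isLevel hcls
  have hX : 0 < Fintype.card X := Fintype.card_pos
  -- The first summand serves the pigeonhole on pairs of blocks, the second the pigeonhole on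
  -- blocks.
  set D := Fintype.card (X × X) * d + Fintype.card X * d with hD
  have hdD : d ≤ D := (Nat.le_mul_of_pos_left d hX).trans (Nat.le_add_left _ _)
  have hsum : ∀ τ : Types L E,
      low D τ.sizes + ∑ i ∈ Finset.Icc 1 k, i * gap D τ.sizes i = τ.sizes.sum := by
    intro τ
    obtain ⟨S, rfl⟩ := τ.exists_of
    exact (sum_eq_low_add D k _ fun t ht => hk ▸ numGE_sizes_le hd (by omega) S).symm
  have := exists_polynomial_of_gaps (T := Types L E) k (Fintype.card X * D)
    (fun τ => low D τ.sizes) (fun τ => gap D τ.sizes)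
    (fun n => by simp only [hsum]; exact finite_types hcls n)
    (fun τ => by
      obtain ⟨S, rfl⟩ := τ.exists_of
      exact low_sizes_le hcls S)
    (fun r c => card_types_min hd (Nat.le_add_right _ _) (Nat.le_add_left _ _) k r c)
    (by
      obtain ⟨S, hS⟩ := exists_gap_pos (D := D) hd hdD hsurj hsep hk
      exact ⟨Types.of S, hS⟩)
  simp only [hsum, ← profile_eq] at this
  exact this

end Types

end MonoDec

namespace MonoDec

open Filter Topology

/-! ### Asymptotics of series with denominator `(1 - Z) ⋯ (1 - Z^k)` -/

section Asymptotics

theorem pow_add_le_add_pow (b h k : ℕ) :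
    b ^ (k + 1) + (k + 1) * h * b ^ k ≤ (b + h) ^ (k + 1) := by
  induction k with
  | zero => simp
  | succ k ih =>
    calc b ^ (k + 1 + 1) + (k + 1 + 1) * h * b ^ (k + 1)
        ≤ (b ^ (k + 1) + (k + 1) * h * b ^ k) * (b + h) := by
          have : 0 ≤ (k + 1) * h * h * b ^ k := Nat.zero_le _
          ring_nf at this ⊢
          omega
      _ ≤ (b + h) ^ (k + 1) * (b + h) := Nat.mul_le_mul_right _ ih

theorem add_pow_le_pow_add (b h k : ℕ) :
    (b + h) ^ (k + 1) ≤ b ^ (k + 1) + (k + 1) * h * (b + h) ^ k := by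
  induction k with
  | zero => simp
  | succ k ih =>
    have h1 : b ^ (k + 1) ≤ (b + h) ^ (k + 1) := Nat.pow_le_pow_left (Nat.le_add_right _ _) _
    calc (b + h) ^ (k + 1 + 1) = (b + h) ^ (k + 1) * b + h * (b + h) ^ (k + 1) := by ring
      _ ≤ (b ^ (k + 1) + (k + 1) * h * (b + h) ^ k) * b + h * (b + h) ^ (k + 1) := by gcongr
      _ ≤ (b ^ (k + 1) + (k + 1) * h * (b + h) ^ k) * b + (k + 1) * h * (b + h) ^ k * h +
          h * (b + h) ^ (k + 1) := by omega
      _ = b ^ (k + 1 + 1) + (k + 1 + 1) * h * (b + h) ^ (k + 1) := by ring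

/-- The number of partitions of `n` into parts of size at most `k`. -/
def numParts : ℕ → ℕ → ℕ
  | 0, n => if n = 0 then 1 else 0
  | k + 1, n => numParts k n + if k + 1 ≤ n then numParts (k + 1) (n - (k + 1)) else 0
termination_by k n => (k, n)

theorem numParts_succ (k n : ℕ) : numParts (k + 1) n =
    numParts k n + if k + 1 ≤ n then numParts (k + 1) (n - (k + 1)) else 0 := by
  rw [numParts]

theorem numParts_zero (n : ℕ) : numParts 0 n = if n = 0 then 1 else 0 := by
  rw [numParts]

theorem numParts_one (n : ℕ) : numParts 1 n = 1 := by
  induction n with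
  | zero => rw [numParts_succ, numParts_zero]; simp
  | succ n ih =>
    rw [numParts_succ, numParts_zero, if_neg (by omega), if_pos (by omega), zero_add, zero_add,
      Nat.add_sub_cancel, ih]

/-- The recurrence sums `numParts (k + 1)` along steps of length `k + 2`; `add_pow_le_pow_add`
bounds the growth of the power over one step. The constant gains the factor `(k + 1) * (k + 2)` at
each stage. -/
theorem pow_le_numParts (k n : ℕ) :
    n ^ k ≤ k.factorial * (k + 1).factorial * numParts (k + 1) n := by
  induction k generalizing n with
  | zero => simp [numParts_one]
  | succ k ih =>
    have hC : (k + 1).factorial * (k + 1 + 1).factorial =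
        (k + 1) * (k + 2) * (k.factorial * (k + 1).factorial) := by
      rw [Nat.factorial_succ (k + 1), Nat.factorial_succ k]; ring
    rw [hC]
    induction n using Nat.strong_induction_on with
    | _ n ihn =>
      have h1 := Nat.mul_le_mul_left ((k + 1) * (k + 2)) (ih n)
      rw [numParts_succ]
      split_ifs with h
      · obtain ⟨m, rfl⟩ := Nat.exists_eq_add_of_le' h
        have h2 := ihn m (by omega)
        rw [Nat.add_sub_cancel]
        have h3 := add_pow_le_pow_add m (k + 2) k
        calc (m + (k + 1 + 1)) ^ (k + 1) ≤ m ^ (k + 1) + (k + 1) * (k + 2) * (m + (k + 2)) ^ k := h3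
          _ ≤ _ := by
            rw [mul_add _ (numParts (k + 1) _), mul_assoc _ _ (numParts (k + 1) _)]
            exact (Nat.add_comm _ _).trans_le (Nat.add_le_add h1 h2)
      · rw [add_zero, mul_assoc]
        refine le_trans ?_ h1
        rw [pow_succ, mul_comm]
        gcongr
        nlinarith

/-- The same summation in the other direction; the shift `b` grows by `k + 2` to absorb the error of
one step. -/
theorem exists_numParts_le (k : ℕ) :
    ∃ b, ∀ n, k.factorial * (k + 1).factorial * numParts (k + 1) n ≤ (n + b) ^ k := by
  induction k with
  | zero => exact ⟨0, fun n => by simp [numParts_one]⟩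
  | succ k ih =>
    obtain ⟨b, ih⟩ := ih
    have hC : (k + 1).factorial * (k + 1 + 1).factorial =
        (k + 1) * (k + 2) * (k.factorial * (k + 1).factorial) := by
      rw [Nat.factorial_succ (k + 1), Nat.factorial_succ k]; ring
    refine ⟨b + (k + 2), fun n => ?_⟩
    rw [hC]
    induction n using Nat.strong_induction_on with
    | _ n ihn =>
      have h1 := Nat.mul_le_mul_left ((k + 1) * (k + 2)) (ih n)
      have h3 := pow_add_le_add_pow (n + b) (k + 2) k
      rw [numParts_succ, mul_add, mul_assoc _ _ (numParts (k + 1) _), ← add_assoc n]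
      split_ifs with h
      · obtain ⟨m, rfl⟩ := Nat.exists_eq_add_of_le' h
        have h2 := ihn m (by omega)
        rw [Nat.add_sub_cancel]
        rw [show m + (b + (k + 2)) = m + (k + 1 + 1) + b by omega] at h2
        omega
      · omega

theorem mk_numParts_mul (k : ℕ) :
    (PowerSeries.mk fun n => (numParts k n : ℤ)) *
      ∏ i ∈ Finset.Icc 1 k, (1 - PowerSeries.X ^ i) = 1 := by
  induction k with
  | zero =>
    ext n
    simp [numParts_zero, PowerSeries.coeff_one]
  | succ k ih =>
    have : (PowerSeries.mk fun n => (numParts (k + 1) n : ℤ)) * (1 - PowerSeries.X ^ (k + 1)) =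
        PowerSeries.mk fun n => (numParts k n : ℤ) := by
      ext n
      rw [mul_sub, mul_one, map_sub, PowerSeries.coeff_mul_X_pow']
      simp only [PowerSeries.coeff_mk]
      rw [numParts_succ]
      split_ifs <;> push_cast <;> ring
    rw [Finset.prod_Icc_succ_top (by omega), mul_comm (∏ i ∈ _, _), ← mul_assoc, this, ih]

theorem tendsto_add_div_pow (c : ℝ) (k : ℕ) :
    Tendsto (fun n : ℕ => ((n : ℝ) + c) ^ k / (n : ℝ) ^ k) atTop (𝓝 1) := by
  have h1 : Tendsto (fun n : ℕ => (1 + c / (n : ℝ)) ^ k) atTop (𝓝 1) := by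
    have := ((tendsto_const_div_atTop_nhds_zero_nat c).const_add 1).pow k
    simpa using this
  refine h1.congr' ?_
  filter_upwards [eventually_gt_atTop 0] with n hn
  have : (n : ℝ) ≠ 0 := by positivity
  rw [← div_pow]
  congr 1
  field_simp

theorem tendsto_numParts (k j : ℕ) :
    Tendsto (fun n : ℕ => (numParts (k + 1) (n - j) : ℝ) / (n : ℝ) ^ k) atTop
      (𝓝 (1 / (k.factorial * (k + 1).factorial))) := by
  obtain ⟨b, hb⟩ := exists_numParts_le k
  set C : ℝ := k.factorial * (k + 1).factorial with hC
  have hC0 : 0 < C := by positivity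
  have e1 := (tendsto_add_div_pow (-(j : ℝ)) k).div_const C
  have e2 := (tendsto_add_div_pow (b : ℝ) k).div_const C
  refine tendsto_of_tendsto_of_tendsto_of_le_of_le' e1 e2 ?_ ?_
  · filter_upwards [eventually_ge_atTop j] with n hn
    rw [div_right_comm]
    gcongr
    rw [div_le_iff₀ hC0]
    have := pow_le_numParts k (n - j)
    have h2 : (((n - j : ℕ) : ℝ)) ^ k ≤ C * numParts (k + 1) (n - j) := by
      rw [hC]; exact_mod_cast this
    rw [Nat.cast_sub hn] at h2
    rw [← sub_eq_add_neg]
    linarith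
  · refine Eventually.of_forall fun n => ?_
    rw [div_right_comm]
    gcongr
    rw [le_div_iff₀ hC0]
    have h2 : C * numParts (k + 1) (n - j) ≤ (((n - j : ℕ) : ℝ) + b) ^ k := by
      rw [hC]; exact_mod_cast hb (n - j)
    have h3 : (((n - j : ℕ) : ℝ) + b) ^ k ≤ ((n : ℝ) + b) ^ k := by
      gcongr
      exact Nat.sub_le _ _
    linarith

theorem coeff_coe_mul_mk {P : Polynomial ℤ} {g : ℕ → ℤ} {n : ℕ} (hn : P.natDegree ≤ n) :
    PowerSeries.coeff n ((P : PowerSeries ℤ) * PowerSeries.mk g) =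
      ∑ j ∈ Finset.range (P.natDegree + 1), P.coeff j * g (n - j) := by
  rw [PowerSeries.coeff_mul, Finset.Nat.sum_antidiagonal_eq_sum_range_succ_mk]
  simp only [Polynomial.coeff_coe, PowerSeries.coeff_mk]
  symm
  refine Finset.sum_subset (Finset.range_mono (by omega)) fun j _ hj => ?_
  rw [Polynomial.coeff_eq_zero_of_natDegree_lt (by simpa using hj), zero_mul]

/-- For large `n`, `f n` is a fixed combination of shifts of `numParts (k + 1)`. All shifts have the
same limit, so the coefficients of `P` add up to `P.eval 1`. -/
theorem tendsto_div_pow_of_mul_prod_eq {k : ℕ} {f : ℕ → ℤ} {P : Polynomial ℤ}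
    (h : PowerSeries.mk f * ∏ i ∈ Finset.Icc 1 (k + 1), (1 - PowerSeries.X ^ i) =
      (P : PowerSeries ℤ)) :
    Tendsto (fun n : ℕ => (f n : ℝ) / (n : ℝ) ^ k) atTop
      (𝓝 ((P.eval 1 : ℤ) / (k.factorial * (k + 1).factorial))) := by
  have h1 : PowerSeries.mk f =
      (P : PowerSeries ℤ) * PowerSeries.mk fun n => (numParts (k + 1) n : ℤ) := by
    rw [← h, mul_assoc, mul_comm (∏ i ∈ _, _), mk_numParts_mul, mul_one]
  have h2 : Tendsto (fun n : ℕ => ∑ j ∈ Finset.range (P.natDegree + 1),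
      (P.coeff j : ℝ) * ((numParts (k + 1) (n - j) : ℝ) / (n : ℝ) ^ k)) atTop
      (𝓝 (∑ j ∈ Finset.range (P.natDegree + 1),
        (P.coeff j : ℝ) * (1 / (k.factorial * (k + 1).factorial)))) :=
    tendsto_finsetSum _ fun j _ => (tendsto_numParts k j).const_mul _
  rw [← Finset.sum_mul, ← Int.cast_sum, mul_one_div] at h2
  have h3 : P.eval 1 = ∑ j ∈ Finset.range (P.natDegree + 1), P.coeff j := by
    rw [Polynomial.eval_eq_sum_range]; simp
  rw [h3]
  refine h2.congr' ?_
  filter_upwards [eventually_ge_atTop P.natDegree] with n hn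
  have h4 := congrArg (PowerSeries.coeff n) h1
  rw [PowerSeries.coeff_mk, coeff_coe_mul_mk hn] at h4
  rw [h4]
  push_cast
  rw [Finset.sum_div]
  exact Finset.sum_congr rfl fun j _ => by rw [mul_div_assoc]

end Asymptotics

/-! ### Quasi-polynomials -/

section QuasiPolynomial

/-- The coefficients of `1 / (1 - Z^N)^(d + 1)`. -/
def stepChoose (N d n : ℕ) : ℕ := if N ∣ n then (n / N + d).choose d else 0

theorem mk_stepChoose_mul {N : ℕ} (hN : 0 < N) (d : ℕ) :
    (PowerSeries.mk fun n => (stepChoose N d n : ℤ)) * (1 - PowerSeries.X ^ N) ^ (d + 1) = 1 := by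
  -- Multiplication by `1 - Z^N` takes differences at distance `N`; the induction on `d` is then
  -- Pascal's rule.
  have key : ∀ g g' : ℕ → ℕ, (∀ n, g' (n + N) = g (n + N) + g' n) → (∀ n < N, g' n = g n) →
      (PowerSeries.mk fun n => (g' n : ℤ)) * (1 - PowerSeries.X ^ N) =
        PowerSeries.mk fun n => (g n : ℤ) := by
    intro g g' h1 h2
    ext n
    rw [mul_sub, mul_one, map_sub, PowerSeries.coeff_mul_X_pow']
    simp only [PowerSeries.coeff_mk]
    split_ifs with h
    · obtain ⟨m, rfl⟩ := Nat.exists_eq_add_of_le' h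
      rw [h1, Nat.add_sub_cancel]
      push_cast
      ring
    · rw [h2 n (by omega), sub_zero]
  induction d with
  | zero =>
    rw [zero_add, pow_one, key (fun n => if n = 0 then 1 else 0)]
    · ext n
      simp [PowerSeries.coeff_one]
    · intro n
      have : n + N ≠ 0 := by omega
      rw [if_neg this, zero_add]
      simp [stepChoose]
    · intro n hn
      by_cases h0 : n = 0
      · simp [stepChoose, h0]
      · have : ¬ N ∣ n := fun h => by
          have := Nat.le_of_dvd (Nat.pos_of_ne_zero h0) h
          omega
        simp [stepChoose, h0, this]
  | succ d ih =>
    rw [pow_succ', ← mul_assoc, key (stepChoose N d), ih]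
    · intro n
      unfold stepChoose
      rw [Nat.add_div_right _ hN]
      simp only [Nat.dvd_add_self_right]
      split_ifs
      · rw [show (n / N).succ + (d + 1) = (n / N + 1 + d) + 1 by omega, Nat.choose_succ_succ,
          show n / N + (d + 1) = n / N + 1 + d by omega]
      · rfl
    · intro n hn
      unfold stepChoose
      rw [Nat.div_eq_of_lt hn]
      simp

theorem exists_polynomial_choose (d : ℕ) : ∃ p : Polynomial ℝ, p.natDegree ≤ d ∧
    ∀ m : ℕ, p.eval (m : ℝ) = ((m + d).choose d : ℝ) := by
  refine ⟨Polynomial.C (1 / (d.factorial : ℝ)) * (ascPochhammer ℝ d).comp (Polynomial.X + 1),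
    ?_, fun m => ?_⟩
  · refine (Polynomial.natDegree_C_mul_le _ _).trans ?_
    rw [Polynomial.natDegree_comp, ascPochhammer_natDegree]
    have : (Polynomial.X + 1 : Polynomial ℝ).natDegree = 1 := Polynomial.natDegree_X_add_C 1
    rw [this, mul_one]
  · have h1 : (ascPochhammer ℝ d).eval ((m : ℝ) + 1) = ((m + 1).ascFactorial d : ℝ) := by
      rw [← ascPochhammer_nat_eq_ascFactorial, ascPochhammer_eval_cast, Nat.cast_succ]
    simp only [Polynomial.eval_mul, Polynomial.eval_C, Polynomial.eval_comp, Polynomial.eval_add,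
      Polynomial.eval_X, Polynomial.eval_one]
    rw [h1, Nat.ascFactorial_eq_factorial_mul_choose]
    have : (d.factorial : ℝ) ≠ 0 := by positivity
    push_cast
    field_simp

theorem exists_periodic_of_mul_prod_eq {k : ℕ} {f : ℕ → ℤ} {P : Polynomial ℤ}
    (h : PowerSeries.mk f * ∏ i ∈ Finset.Icc 1 (k + 1), (1 - PowerSeries.X ^ i) =
      (P : PowerSeries ℤ)) :
    ∃ (N : ℕ) (a : ℕ → ℕ → ℝ), 0 < N ∧ (∀ i, Function.Periodic (a i) N) ∧
      ∀ᶠ n : ℕ in atTop, (f n : ℝ) = ∑ i ∈ Finset.range (k + 1), a i n * (n : ℝ) ^ i := by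
  -- Every `i ≤ k + 1` divides `N`, so the denominator divides `(1 - Z^N)^(k + 1)`.
  set N := (k + 1).factorial with hN
  have hN0 : 0 < N := Nat.factorial_pos _
  have hdvd : ∀ i ∈ Finset.Icc 1 (k + 1), (1 - Polynomial.X ^ i : Polynomial ℤ) ∣
      1 - Polynomial.X ^ N := by
    intro i hi
    obtain ⟨h1, h2⟩ := Finset.mem_Icc.1 hi
    obtain ⟨m, hm⟩ := Nat.dvd_factorial h1 h2
    rw [hN, hm, pow_mul]
    simpa using sub_dvd_pow_sub_pow (1 : Polynomial ℤ) (Polynomial.X ^ i) m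
  obtain ⟨R, hR⟩ : (∏ i ∈ Finset.Icc 1 (k + 1), (1 - Polynomial.X ^ i : Polynomial ℤ)) ∣
      (1 - Polynomial.X ^ N) ^ (k + 1) := by
    have := Finset.prod_dvd_prod_of_dvd _ _ hdvd
    simpa using this
  have hR' : ((1 - PowerSeries.X ^ N) ^ (k + 1) : PowerSeries ℤ) =
      (∏ i ∈ Finset.Icc 1 (k + 1), (1 - PowerSeries.X ^ i)) * (R : PowerSeries ℤ) := by
    have := congrArg (Polynomial.coeToPowerSeries.ringHom (R := ℤ)) hR
    rw [map_mul, map_prod] at this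
    simpa using this
  have h1 : PowerSeries.mk f =
      ((P * R : Polynomial ℤ) : PowerSeries ℤ) *
        PowerSeries.mk fun n => (stepChoose N k n : ℤ) := by
    have e := mk_stepChoose_mul hN0 k
    rw [hR'] at e
    rw [Polynomial.coe_mul, ← h, mul_assoc, mul_assoc, ← mul_assoc (∏ i ∈ _, _), mul_comm _
      (PowerSeries.mk fun n => (stepChoose N k n : ℤ)), e, mul_one]
  obtain ⟨p, hp, hp'⟩ := exists_polynomial_choose k
  -- On the residue class of `j` modulo `N`, the shifted coefficient is this polynomial in `n`, of
  -- degree at most `k`; elsewhere it vanishes.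
  let q : ℕ → Polynomial ℝ := fun j =>
    p.comp (Polynomial.C (1 / (N : ℝ)) * (Polynomial.X - Polynomial.C (j : ℝ)))
  have hq : ∀ j, (q j).natDegree < k + 1 := by
    intro j
    refine Nat.lt_succ_of_le (Polynomial.natDegree_comp_le.trans ?_)
    have : (Polynomial.C (1 / (N : ℝ)) * (Polynomial.X - Polynomial.C (j : ℝ))).natDegree ≤ 1 :=
      (Polynomial.natDegree_C_mul_le _ _).trans (Polynomial.natDegree_X_sub_C _).le
    nlinarith
  have hstep : ∀ j n : ℕ, j ≤ n → (stepChoose N k (n - j) : ℝ) =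
      if n ≡ j [MOD N] then (q j).eval (n : ℝ) else 0 := by
    intro j n hjn
    unfold stepChoose
    have : N ∣ n - j ↔ n ≡ j [MOD N] := by
      rw [Nat.ModEq.comm]; exact (Nat.modEq_iff_dvd' hjn).symm
    rw [if_congr this rfl rfl]
    split_ifs with hmod
    · obtain ⟨m, hm⟩ := this.2 hmod
      have hn : (n : ℝ) - j = N * m := by
        rw [← Nat.cast_sub hjn, hm]; push_cast; rfl
      have hN0' : (N : ℝ) ≠ 0 := by positivity
      rw [hm, Nat.mul_div_cancel_left _ hN0, ← hp']
      simp only [q, Polynomial.eval_comp, Polynomial.eval_mul, Polynomial.eval_C,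
        Polynomial.eval_sub, Polynomial.eval_X, hn]
      congr 1
      field_simp
    · simp
  refine ⟨N, fun i n => ∑ j ∈ Finset.range ((P * R).natDegree + 1),
    ((P * R).coeff j : ℝ) * if n ≡ j [MOD N] then (q j).coeff i else 0, hN0, fun i n => ?_, ?_⟩
  · refine Finset.sum_congr rfl fun j _ => ?_
    congr 1
    exact if_congr (by simp [Nat.ModEq]) rfl rfl
  · filter_upwards [eventually_ge_atTop (P * R).natDegree] with n hn
    have h4 := congrArg (PowerSeries.coeff n) h1
    rw [PowerSeries.coeff_mk, coeff_coe_mul_mk hn] at h4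
    rw [h4]
    push_cast
    simp only [Finset.sum_mul]
    rw [Finset.sum_comm]
    refine Finset.sum_congr rfl fun j hj => ?_
    rw [hstep j n (by have := Finset.mem_range.1 hj; omega)]
    simp only [mul_assoc]
    rw [← Finset.mul_sum]
    congr 1
    split_ifs
    · exact Polynomial.eval_eq_sum_range' (hq j) _
    · simp

theorem exists_bound_of_periodic {a : ℕ → ℝ} {N : ℕ} (hN : 0 < N) (ha : Function.Periodic a N) :
    ∃ B, ∀ n, |a n| ≤ B := by
  refine ⟨∑ m ∈ Finset.range N, |a m|, fun n => ?_⟩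
  rw [← ha.map_mod_nat n]
  exact Finset.single_le_sum (f := fun m => |a m|) (fun _ _ => abs_nonneg _)
    (Finset.mem_range.2 (Nat.mod_lt _ hN))

/-- Quasi-polynomiality and asymptotics of the coefficients of a rational series with denominator
`(1 - Z) ⋯ (1 - Z^(k + 1))`. -/
theorem quasiPolynomial_of_mul_prod_eq {k : ℕ} {f : ℕ → ℕ} {P : Polynomial ℤ}
    (hP : P.eval 1 ≠ 0)
    (h : (PowerSeries.mk fun n => (f n : ℤ)) *
      ∏ i ∈ Finset.Icc 1 (k + 1), (1 - PowerSeries.X ^ i) = (P : PowerSeries ℤ)) :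
    (∃ q : ℕ → ℝ, IsQuasiPolynomialOfDegree q k ∧ ∀ᶠ n in atTop, (f n : ℝ) = q n) ∧
    (∃ a : ℝ, 0 < a ∧
      Asymptotics.IsEquivalent atTop (fun n : ℕ => (f n : ℝ)) (fun n : ℕ => a * (n : ℝ) ^ k)) := by
  have hlim := tendsto_div_pow_of_mul_prod_eq h
  simp only [Int.cast_natCast] at hlim
  set α : ℝ := (P.eval 1 : ℤ) / (k.factorial * (k + 1).factorial) with hα
  have hα0 : 0 < α := by
    -- The sign of `P.eval 1` is not known in advance: the limit is nonnegative because `f` is, and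
    -- nonzero by `hP`.
    refine lt_of_le_of_ne (ge_of_tendsto' hlim fun n => by positivity) (Ne.symm ?_)
    rw [hα]
    have : ((P.eval 1 : ℤ) : ℝ) ≠ 0 := by exact_mod_cast hP
    positivity
  constructor
  · obtain ⟨N, a, hN, ha, hev⟩ := exists_periodic_of_mul_prod_eq h
    simp only [Int.cast_natCast] at hev
    refine ⟨fun n => ∑ i ∈ Finset.range (k + 1), a i n * (n : ℝ) ^ i,
      ⟨a, fun i _ => ⟨N, hN, ha i⟩, ?_, fun n => rfl⟩, hev⟩
    by_contra hcon
    push Not at hcon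
    -- If the top coefficient vanished identically, the remaining terms, with bounded coefficients,
    -- would make `f n / n^k` tend to `0`.
    have h0 : Tendsto (fun n : ℕ => ∑ i ∈ Finset.range k, a i n * ((n : ℝ) ^ i / (n : ℝ) ^ k))
        atTop (𝓝 (∑ i ∈ Finset.range k, (0 : ℝ))) := by
      refine tendsto_finsetSum _ fun i hi => ?_
      obtain ⟨B, hB⟩ := exists_bound_of_periodic hN (ha i)
      have hz : Tendsto (fun n : ℕ => (n : ℝ) ^ i / (n : ℝ) ^ k) atTop (𝓝 0) :=
        (tendsto_pow_div_pow_atTop_zero (Finset.mem_range.1 hi)).comp tendsto_natCast_atTop_atTop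
      refine squeeze_zero_norm (a := fun n : ℕ => B * ((n : ℝ) ^ i / (n : ℝ) ^ k)) (fun n => ?_)
        (by simpa using hz.const_mul B)
      rw [norm_mul, Real.norm_eq_abs, Real.norm_of_nonneg (by positivity)]
      gcongr
      exact hB n
    rw [Finset.sum_const_zero] at h0
    refine hα0.ne' (tendsto_nhds_unique hlim (h0.congr' ?_))
    filter_upwards [hev] with n hn
    rw [hn, Finset.sum_range_succ, hcon n, zero_mul, add_zero, Finset.sum_div]
    exact Finset.sum_congr rfl fun i _ => by rw [mul_div_assoc]
  · refine ⟨α, hα0, ?_⟩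
    refine Asymptotics.isEquivalent_of_tendsto_one ?_
    have := hlim.div_const α
    rw [div_self hα0.ne'] at this
    refine this.congr fun n => ?_
    simp only [Pi.div_apply]
    rw [div_div, mul_comm]

end QuasiPolynomial

end MonoDec

namespace MonoDec

open FirstOrder Classical

/-! ### The blocks of the minimal monomorphic decomposition -/

section Minimal

variable {L : FirstOrder.Language.{u, v}} [L.IsRelational] {E : Type w} [L.Structure E]

theorem minimalMonomorphicDecomposition_eq :
    minimalMonomorphicDecomposition L E = exchangeSetoid L E :=
  (isGreatest_minimalMonomorphicDecomposition L E).unique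
    ⟨isMonomorphicDecomposition_exchangeSetoid L, fun _ hs => le_exchangeSetoid L hs⟩

theorem cnt_mk_eq_ncard (s : Setoid E) (A : Finset E) (y : E) :
    cnt (Quotient.mk s) A (Quotient.mk s y) = ((A : Set E) ∩ {x | s x y}).ncard := by
  rw [cnt, ← Set.ncard_coe_finset]
  congr 1
  ext x
  simp only [Finset.coe_filter, Set.mem_inter_iff, Finset.mem_coe, Set.mem_ofPred_eq]
  exact and_congr_right fun _ => Quotient.eq

theorem IsMonomorphicDecomposition.sameType {s : Setoid E} (hs : IsMonomorphicDecomposition L s)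
    (A B : Finset E) (h : ∀ x, cnt (Quotient.mk s) A x = cnt (Quotient.mk s) B x) :
    SameType L A B := by
  refine hs A B ?_
  rintro _ ⟨y, rfl⟩
  rw [← cnt_mk_eq_ncard, ← cnt_mk_eq_ncard, h]

theorem exists_not_exchIn {a b : E}
    (h : Quotient.mk (exchangeSetoid L E) a ≠ Quotient.mk (exchangeSetoid L E) b) :
    ∃ S : Finset E, ¬ ExchIn L S a b := by
  by_contra hcon
  push Not at hcon
  exact h (Quotient.sound fun B ha hb => hcon B B (Finset.Subset.refl _) ha hb)

theorem finite_quotient_exchangeSetoid (h : HasFiniteMonomorphicDecomposition L E) :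
    Finite (Quotient (exchangeSetoid L E)) := by
  obtain ⟨s, hs, hfin⟩ := h
  have : Finite s.classes := hfin
  have : Finite (Quotient s) := Finite.of_equiv _ (Setoid.quotientEquivClasses s).symm
  exact Finite.of_surjective (Quotient.map id fun a b hab => le_exchangeSetoid L hs hab)
    fun q => by
      obtain ⟨a, rfl⟩ := Quotient.exists_rep q
      exact ⟨Quotient.mk s a, rfl⟩

theorem monomorphicDimension_eq :
    monomorphicDimension L E =
      {x | (Quotient.mk (exchangeSetoid L E) ⁻¹' {x}).Infinite}.ncard := by
  have hpre : ∀ y, Quotient.mk (exchangeSetoid L E) ⁻¹' {Quotient.mk (exchangeSetoid L E) y} =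
      {x | (exchangeSetoid L E) x y} := fun y => Set.ext fun x => Quotient.eq
  rw [monomorphicDimension, minimalMonomorphicDecomposition_eq]
  have hinj : Function.Injective fun x => Quotient.mk (exchangeSetoid L E) ⁻¹' {x} := by
    intro x y h
    obtain ⟨a, rfl⟩ := Quotient.exists_rep x
    have h' : Quotient.mk (exchangeSetoid L E) ⁻¹' {Quotient.mk (exchangeSetoid L E) a} =
        Quotient.mk (exchangeSetoid L E) ⁻¹' {y} := h
    have ha : a ∈ Quotient.mk (exchangeSetoid L E) ⁻¹' {y} := by
      rw [← h']; rfl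
    exact ha
  rw [← Set.ncard_image_of_injective _ hinj]
  congr 1
  ext c
  constructor
  · rintro ⟨⟨y, rfl⟩, hc⟩
    refine ⟨Quotient.mk (exchangeSetoid L E) y, ?_, hpre y⟩
    rw [Set.mem_ofPred_eq, hpre]
    exact hc
  · rintro ⟨x, hx, rfl⟩
    obtain ⟨y, rfl⟩ := Quotient.exists_rep x
    exact ⟨⟨y, hpre y⟩, hx⟩

/-- Infinite pigeonhole: finitely many blocks cover an infinite set. -/
theorem one_le_monomorphicDimension [Infinite E] (h : HasFiniteMonomorphicDecomposition L E) :
    1 ≤ monomorphicDimension L E := by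
  have := finite_quotient_exchangeSetoid h
  rw [monomorphicDimension_eq]
  obtain ⟨x, hx⟩ := Finite.exists_infinite_fiber (Quotient.mk (exchangeSetoid L E))
  exact (Set.ncard_pos (Set.toFinite _)).2 ⟨x, Set.infinite_coe_iff.1 hx⟩

end Minimal

end MonoDec

/-! ### Assembly for the blocks of the minimal decomposition -/

theorem mainTheorem1 (L : FirstOrder.Language.{u, v}) [L.IsRelational]
    (E : Type w) [Infinite E] [L.Structure E]
    (hR : MonoDec.HasFiniteMonomorphicDecomposition L E)
    (k : ℕ) (hk : k = MonoDec.monomorphicDimension L E) :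
    1 ≤ k ∧
    (∀ n, Finite (MonoDec.IsoTypes L E n)) ∧
    (∃ P : Polynomial ℤ, P.eval 1 ≠ 0 ∧
      MonoDec.generatingSeries L E * ∏ i ∈ Finset.Icc 1 k, (1 - PowerSeries.X ^ i) =
        (P : PowerSeries ℤ)) ∧
    (∃ q : ℕ → ℝ, MonoDec.IsQuasiPolynomialOfDegree q (k - 1) ∧
      ∀ᶠ n in Filter.atTop, (MonoDec.profile L E n : ℝ) = q n) ∧
    (∃ a : ℝ, 0 < a ∧
      Asymptotics.IsEquivalent Filter.atTop (fun n : ℕ => (MonoDec.profile L E n : ℝ))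
        (fun n : ℕ => a * (n : ℝ) ^ (k - 1))) := by
  have hk1 : 1 ≤ k := hk ▸ MonoDec.one_le_monomorphicDimension hR
  have hfin := MonoDec.finite_quotient_exchangeSetoid hR
  cases nonempty_fintype (Quotient (MonoDec.exchangeSetoid L E))
  have hcls := (MonoDec.isMonomorphicDecomposition_exchangeSetoid (E := E) L).sameType
  have hne : Nonempty (Quotient (MonoDec.exchangeSetoid L E)) :=
    ⟨Quotient.mk _ (Classical.arbitrary E)⟩
  obtain ⟨P, hP, h⟩ := MonoDec.exists_polynomial_generatingSeries hcls Quotient.exists_rep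
    (fun a b => MonoDec.exists_not_exchIn) (hk.trans MonoDec.monomorphicDimension_eq)
  refine ⟨hk1, MonoDec.finite_isoTypes hcls, ⟨P, hP, h⟩, ?_⟩
  obtain ⟨m, rfl⟩ := Nat.exists_eq_add_of_le' hk1
  exact MonoDec.quasiPolynomial_of_mul_prod_eq hP h
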